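/- There are an algorithm and a constant $c$ such that for every nonempty finite simple $P_4$-sparse graph $G$ with $n$ vertices and $m$ edges, given by its adjacency lists (the vertices being numbered $0,\dots,n-1$ and the lists being in arbitrary order), the algorithm outputs the cycle-convexity hull number $\mathrm{hn}_{cc}(G)$ after at most $c\,(n+m)$ steps; that is, $\mathrm{hn}_{cc}(G)$ can be computed in linear time for $P_4$-sparse graphs. Here time is measured as the number of elementary steps (assignments of constants, additions, truncated subtractions, loads, stores, and comparisons, each of unit cost) of a program on a random access machine, all of whose written values stay at most $c\,(n+m)$, i.e. with words of $O(\log(n+m))$ bits. Definitions. A graph is $P_4$-sparse if every set of five of its vertices contains at most one 4-element subset inducing a path on four vertices. For $C\subseteq V(G)$ let $I_{cc}(C)=C\cup\{v\in V(G) : \text{there is a cycle in } G[C\cup\{v\}] \text{ containing } v\}$. A set $C$ is convex if $I_{cc}(C)=C$; the convex hull of $S\subseteq V(G)$ is the smallest convex set containing $S$; $S$ is a hull set if its convex hull is $V(G)$; and $\mathrm{hn}_{cc}(G)$ is the minimum cardinality of a hull set of $G$. -/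

import Mathlib

namespace CycleConvexity

/-! ### Cycle convexity of a simple graph -/

/-- The interval function of the cycle convexity: `C` together with all vertices `v` that lie on
a cycle of `G` all of whose vertices belong to `C ∪ {v}`. -/
def interval {V : Type*} (G : SimpleGraph V) (C : Set V) : Set V :=
  C ∪ {v | ∃ p : G.Walk v v, p.IsCycle ∧ ∀ w ∈ p.support, w ∈ insert v C}

/-- A set of vertices is convex if it is a fixed point of the interval function. -/
def IsConvex {V : Type*} (G : SimpleGraph V) (C : Set V) : Prop :=
  interval G C = C

/-- The convex hull: the smallest convex set that contains `S`. -/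
def hull {V : Type*} (G : SimpleGraph V) (S : Set V) : Set V :=
  ⋂₀ {C | IsConvex G C ∧ S ⊆ C}

/-- `S` is a hull set if its convex hull is the whole vertex set. -/
def IsHullSet {V : Type*} (G : SimpleGraph V) (S : Set V) : Prop :=
  hull G S = Set.univ

/-- The hull number in the cycle convexity: the least cardinality of a hull set
(the vertex set itself is a hull set, so the minimum is over a nonempty set). -/
noncomputable def hullNumber {V : Type*} [Fintype V] (G : SimpleGraph V) : ℕ :=
  sInf {k | ∃ S : Finset V, IsHullSet G (S : Set V) ∧ S.card = k}

/-! ### `P₄`-sparse graphs -/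

/-- The set `B` induces in `G` a path on four vertices. -/
def InducesP4 {V : Type*} (G : SimpleGraph V) (B : Finset V) : Prop :=
  Nonempty (G.induce (B : Set V) ≃g SimpleGraph.pathGraph 4)

/-- Every set of five vertices contains at most one induced path on four vertices. -/
def IsP4Sparse {V : Type*} (G : SimpleGraph V) : Prop :=
  ∀ A : Finset V, A.card = 5 → ∀ B₁ B₂ : Finset V, B₁ ⊆ A → B₂ ⊆ A →
    InducesP4 G B₁ → InducesP4 G B₂ → B₁ = B₂

/-! ### A word RAM, with structured programs -/

/-- Programs of the random access machine. The machine has registers and a memory, both indexed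
by natural numbers; `r`, `s`, `q` below are names of registers. -/
inductive Prog : Type
  /-- `r := k`. -/
  | const (r k : ℕ) : Prog
  /-- `r := s + q`. -/
  | add (r s q : ℕ) : Prog
  /-- `r := s - q`, truncated at zero. -/
  | sub (r s q : ℕ) : Prog
  /-- `r := mem[s]`. -/
  | load (r s : ℕ) : Prog
  /-- `mem[r] := s`. -/
  | store (r s : ℕ) : Prog
  /-- First `P`, then `Q`. -/
  | seq (P Q : Prog) : Prog
  /-- If `r < s` then `P`, else `Q`. -/
  | branch (r s : ℕ) (P Q : Prog) : Prog
  /-- As long as `r < s`, repeat `P`. -/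
  | loop (r s : ℕ) (P : Prog) : Prog

/-- The contents of the registers and of the memory. -/
@[ext] structure State : Type where
  reg : ℕ → ℕ
  mem : ℕ → ℕ

/-- Write `v` to register `r`. -/
def State.setReg (σ : State) (r v : ℕ) : State :=
  { σ with reg := Function.update σ.reg r v }

/-- Write `v` to the memory cell `a`. -/
def State.setMem (σ : State) (a v : ℕ) : State :=
  { σ with mem := Function.update σ.mem a v }

/-- `Exec W P σ τ t`: on the machine whose words are the numbers `0, …, W`, the program `P`,
started in state `σ`, halts in state `τ` after exactly `t` steps. Every assignment and every
evaluation of a test is one step. A value that exceeds `W` can never be written: a program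
that tries to do so has no execution. -/
inductive Exec (W : ℕ) : Prog → State → State → ℕ → Prop
  | const (r k : ℕ) (σ : State) : k ≤ W →
      Exec W (.const r k) σ (σ.setReg r k) 1
  | add (r s q : ℕ) (σ : State) : σ.reg s + σ.reg q ≤ W →
      Exec W (.add r s q) σ (σ.setReg r (σ.reg s + σ.reg q)) 1
  | sub (r s q : ℕ) (σ : State) : σ.reg s - σ.reg q ≤ W →
      Exec W (.sub r s q) σ (σ.setReg r (σ.reg s - σ.reg q)) 1
  | load (r s : ℕ) (σ : State) : σ.mem (σ.reg s) ≤ W →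
      Exec W (.load r s) σ (σ.setReg r (σ.mem (σ.reg s))) 1
  | store (r s : ℕ) (σ : State) : σ.reg s ≤ W →
      Exec W (.store r s) σ (σ.setMem (σ.reg r) (σ.reg s)) 1
  | seq (P Q : Prog) (σ τ υ : State) (t u : ℕ) :
      Exec W P σ τ t → Exec W Q τ υ u → Exec W (.seq P Q) σ υ (t + u)
  | branch_true (r s : ℕ) (P Q : Prog) (σ τ : State) (t : ℕ) : σ.reg r < σ.reg s →
      Exec W P σ τ t → Exec W (.branch r s P Q) σ τ (t + 1)
  | branch_false (r s : ℕ) (P Q : Prog) (σ τ : State) (t : ℕ) : ¬ σ.reg r < σ.reg s →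
      Exec W Q σ τ t → Exec W (.branch r s P Q) σ τ (t + 1)
  | loop_true (r s : ℕ) (P : Prog) (σ τ υ : State) (t u : ℕ) : σ.reg r < σ.reg s →
      Exec W P σ τ t → Exec W (.loop r s P) τ υ u → Exec W (.loop r s P) σ υ (t + u + 1)
  | loop_false (r s : ℕ) (P : Prog) (σ : State) : ¬ σ.reg r < σ.reg s →
      Exec W (.loop r s P) σ σ 1

/-! ### Graphs as inputs: adjacency lists -/

/-- `adj` lists, for each vertex, its neighbours without repetition, in an arbitrary order. -/
def IsAdjList {n : ℕ} (G : SimpleGraph (Fin n)) (adj : Fin n → List (Fin n)) : Prop :=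
  ∀ v, (adj v).Nodup ∧ ∀ w, w ∈ adj v ↔ G.Adj v w

/-- The adjacency lists, as lists of numbers, in the order of the vertices. -/
def rows {n : ℕ} (adj : Fin n → List (Fin n)) : List (List ℕ) :=
  List.ofFn fun v => (adj v).map Fin.val

/-- The input word. Cell `0` holds the number `n` of vertices; the adjacency lists are written
one after the other from cell `n + 2` on; for `v < n`, cell `1 + v` holds the address at which
the list of `v` begins, and cell `2 + v` the address just after its end. -/
def encode {n : ℕ} (adj : Fin n → List (Fin n)) : List ℕ :=
  n :: ((List.range (n + 1)).map (fun v => n + 2 + ((rows adj).take v).flatten.length)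
    ++ (rows adj).flatten)

/-- The initial state: the input stands at the beginning of the memory, and all other memory
cells and all registers are zero. -/
def initState (input : List ℕ) : State where
  reg := fun _ => 0
  mem := fun i => input.getD i 0

end CycleConvexity

/-!
The hull number is additive over components, and in a `P₄`-sparse graph each component contributes
a number that can be read off from local data.

A set `C` is convex if and only if no vertex outside has two neighbours that are connected inside
`C` (`isConvex_iff`). If a component has a vertex `u` adjacent to all others, then it needs one
vertex for `u` and one for each component that remains when `u` is removed
(`Dominates.subset_of_isConvex`, `card_le_of_isHullSet_of_mem`). Otherwise it needs all its leaves
and two more vertices, or three vertices if it has neither a leaf nor a triangle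
(`IsP4Sparse.exists_generating`, `card_leaves_add_two_le`, `three_le_of_plain`). The upper bound
rests on `IsP4Sparse.closed_of_connected`: in a `P₄`-sparse graph, a connected part of a convex set
with at least three vertices cannot stop growing before it fills its component, unless a leaf or a
dominating vertex intervenes; this replaces the decomposition of `P₄`-sparse graphs into spiders.
The result is the formula `IsP4Sparse.hullNumber_eq`, a sum over vertices.

All its ingredients take linear time. The components have diameter at most three, so three rounds
of propagating minimal labels find them; a vertex dominates its component if its degree is one less
than the size of the component; and a component without leaves is triangle-free if and only if the
neighbourhood of one of its vertices is a colour class of a proper 2-colouring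
(`IsP4Sparse.plain_iff`).

The algorithm is written in a small structured language, whose programs consist of loops over all
vertices with loops over adjacency lists inside. The only arithmetic in this language is the
increment, and its arrays are interleaved in the memory of the machine. So no value can exceed the
number of vertices plus the number of steps, no array can overwrite another one, and every program
of the language runs in linear time with small words (`exists_program`), whatever it computes.
-/

namespace CycleConvexity

/-! ### A structured language on top of the machine -/

/-- The state of an abstract machine with registers and eight arrays of unbounded length. -/
structure AState : Type where
  reg : ℕ → ℕ
  arr : Fin 8 → ℕ → ℕ

/-- Write `v` to register `r`. -/
def AState.setReg (s : AState) (r v : ℕ) : AState :=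
  { s with reg := Function.update s.reg r v }

/-- Write `v` to position `a` of array `k`. -/
def AState.setArr (s : AState) (k : Fin 8) (a v : ℕ) : AState :=
  { s with arr := Function.update s.arr k (Function.update (s.arr k) a v) }

/-- All values in the state are at most `B`. -/
def AState.Bdd (s : AState) (B : ℕ) : Prop :=
  (∀ r, s.reg r ≤ B) ∧ ∀ k a, s.arr k a ≤ B

/-- Loop-free commands. The only arithmetic is the increment, so that one command raises the
largest value by at most one. -/
inductive Cmd : Type
  | zero (r : ℕ) : Cmd
  | inc (r : ℕ) : Cmd
  /-- `r := arr k [s]`. -/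
  | load (r : ℕ) (k : Fin 8) (s : ℕ) : Cmd
  /-- `arr k [s] := r`. -/
  | store (k : Fin 8) (s r : ℕ) : Cmd
  | seq (c d : Cmd) : Cmd
  /-- If `r < s` then `c`, else `d`. -/
  | ite (r s : ℕ) (c d : Cmd) : Cmd

namespace Cmd

/-- The effect of a command on the abstract state. -/
def sem : Cmd → AState → AState
  | zero r, s => s.setReg r 0
  | inc r, s => s.setReg r (s.reg r + 1)
  | load r k q, s => s.setReg r (s.arr k (s.reg q))
  | store k q r, s => s.setArr k (s.reg q) (s.reg r)
  | seq c d, s => d.sem (c.sem s)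
  | ite r q c d, s => if s.reg r < s.reg q then c.sem s else d.sem s

/-- A bound for the running time of the compiled command, and for the growth of the values. The
longest basic command is a memory access, which takes seven steps with its address computation. -/
def size : Cmd → ℕ
  | seq c d => c.size + d.size
  | ite _ _ c d => c.size + d.size + 1
  | _ => 8

/-- Put the address of entry `q` of array `k` into machine register `0`. The arrays are
interleaved behind the input, so that no two of them overlap whatever the index is. -/
def address (k : Fin 8) (q : ℕ) : Prog :=
  .seq (.add 0 (q + 10) (q + 10)) (.seq (.add 0 0 0) (.seq (.add 0 0 0) (.seq (.add 0 0 2)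
    (.seq (.const 8 k) (.add 0 0 8)))))

/-- Translation to machine programs. The abstract register `r` is the machine register `r + 10`.
The other machine registers are: `1`, the number of vertices; `2`, the length of the input; `3`
and `4`, the constants one and zero; `5`, the current vertex; `6` and `7`, the current position
in its adjacency list and the end of that list; `0` and `8`, scratch. -/
def compile : Cmd → Prog
  | zero r => .const (r + 10) 0
  | inc r => .add (r + 10) (r + 10) 3
  | load r k q => .seq (address k q) (.load (r + 10) 0)
  | store k q r => .seq (address k q) (.store 0 (r + 10))
  | seq c d => .seq c.compile d.compile
  | ite r q c d => .branch (r + 10) (q + 10) c.compile d.compile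

end Cmd

/-- The machine state `σ` represents the abstract state `s`: the input `I` is intact, the arrays
are interleaved behind it, and the registers are as described at `Cmd.compile`. -/
structure Rel (I : List ℕ) (n : ℕ) (σ : State) (s : AState) : Prop where
  regs : ∀ r, σ.reg (r + 10) = s.reg r
  arrs : ∀ (k : Fin 8) v, σ.mem (I.length + 8 * v + k) = s.arr k v
  input : ∀ a < I.length, σ.mem a = I.getD a 0
  count : σ.reg 1 = n
  base : σ.reg 2 = I.length
  one : σ.reg 3 = 1
  zero : σ.reg 4 = 0

theorem Rel.setReg {I : List ℕ} {n : ℕ} {σ : State} {s : AState} (h : Rel I n σ s) (r v : ℕ) :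
    Rel I n (σ.setReg (r + 10) v) (s.setReg r v) where
  regs q := by
    by_cases hq : q = r
    · simp [State.setReg, AState.setReg, hq]
    · simp [State.setReg, AState.setReg, hq, h.regs]
  arrs := h.arrs
  input := h.input
  count := by simp [State.setReg, h.count, Function.update]
  base := by simp [State.setReg, h.base, Function.update]
  one := by simp [State.setReg, h.one, Function.update]
  zero := by simp [State.setReg, h.zero, Function.update]

theorem Rel.setHidden {I : List ℕ} {n : ℕ} {σ : State} {s : AState} (h : Rel I n σ s)
    (r v : ℕ) (hr : r = 0 ∨ 5 ≤ r ∧ r < 10) : Rel I n (σ.setReg r v) s := by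
  have key : ∀ q, q ≠ r → (σ.setReg r v).reg q = σ.reg q := fun q hq => by
    simp [State.setReg, hq]
  exact ⟨fun q => by rw [key _ (by omega), h.regs], h.arrs, h.input,
    by rw [key _ (by omega), h.count], by rw [key _ (by omega), h.base],
    by rw [key _ (by omega), h.one], by rw [key _ (by omega), h.zero]⟩

theorem Rel.setArr {I : List ℕ} {n : ℕ} {σ : State} {s : AState} (h : Rel I n σ s)
    (k : Fin 8) (a v : ℕ) : Rel I n (σ.setMem (I.length + 8 * a + k) v) (s.setArr k a v) where
  regs := h.regs
  arrs j b := by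
    have := k.isLt
    have := j.isLt
    by_cases hj : j = k
    · subst hj
      by_cases hb : b = a
      · simp [State.setMem, AState.setArr, hb]
      · have : I.length + 8 * b + (j : ℕ) ≠ I.length + 8 * a + j := by omega
        simp [State.setMem, AState.setArr, hb, h.arrs]
    · have hj' : (j : ℕ) ≠ k := fun e => hj (Fin.ext e)
      have : I.length + 8 * b + (j : ℕ) ≠ I.length + 8 * a + k := by omega
      simp [State.setMem, AState.setArr, hj, this, h.arrs]
  input b hb := by
    have : b ≠ I.length + 8 * a + k := by omega
    simp only [State.setMem, Function.update, this]
    simpa using h.input b hb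
  count := h.count
  base := h.base
  one := h.one
  zero := h.zero

theorem AState.Bdd.mono {s : AState} {B B' : ℕ} (h : s.Bdd B) (hB : B ≤ B') : s.Bdd B' :=
  ⟨fun r => (h.1 r).trans hB, fun k a => (h.2 k a).trans hB⟩

theorem AState.Bdd.setReg {s : AState} {B : ℕ} (h : s.Bdd B) {r v : ℕ} (hv : v ≤ B) :
    (s.setReg r v).Bdd B := by
  refine ⟨fun q => ?_, h.2⟩
  by_cases hq : q = r
  · simpa [AState.setReg, hq] using hv
  · simpa [AState.setReg, hq] using h.1 q

theorem AState.Bdd.setArr {s : AState} {B : ℕ} (h : s.Bdd B) {k : Fin 8} {a v : ℕ}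
    (hv : v ≤ B) : (s.setArr k a v).Bdd B := by
  refine ⟨h.1, fun j b => ?_⟩
  by_cases hj : j = k
  · subst hj
    by_cases hb : b = a
    · simpa [AState.setArr, hb] using hv
    · simpa [AState.setArr, hb] using h.2 j b
  · simpa [AState.setArr, hj] using h.2 j b

theorem Cmd.bdd_sem (c : Cmd) : ∀ {s : AState} {B : ℕ}, s.Bdd B → (c.sem s).Bdd (B + c.size) := by
  induction c with
  | zero r => exact fun h => (h.mono (Nat.le_add_right _ _)).setReg (Nat.zero_le _)
  | inc r =>
    exact fun h => (h.mono (Nat.le_add_right _ _)).setReg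
      (by have := h.1 r; simp only [Cmd.size]; omega)
  | load r k q => exact fun h => (h.mono (Nat.le_add_right _ _)).setReg (le_add_right (h.2 _ _))
  | store k q r => exact fun h => (h.mono (Nat.le_add_right _ _)).setArr (le_add_right (h.1 _))
  | seq c d hc hd => exact fun h => (hd (hc h)).mono (by simp only [Cmd.size]; omega)
  | ite r q c d hc hd =>
    intro s B h
    simp only [Cmd.sem, Cmd.size]
    split_ifs
    · exact (hc h).mono (by omega)
    · exact (hd h).mono (by omega)

/-- The scratch registers of the address computation are the only ones it changes. -/
theorem Cmd.run_address {W : ℕ} {I : List ℕ} {n : ℕ} {σ : State} {s : AState} {B : ℕ}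
    (h : Rel I n σ s) (hs : s.Bdd B) (hW : I.length + 8 * B + 8 ≤ W) (k : Fin 8) (q : ℕ) :
    ∃ τ, Exec W (address k q) σ τ 6 ∧ τ.reg 0 = I.length + 8 * s.reg q + k ∧ Rel I n τ s ∧
      ∀ r, r ≠ 0 → r ≠ 8 → τ.reg r = σ.reg r := by
  have hq := hs.1 q
  have hk := k.isLt
  have e := h.regs q
  have e2 := h.base
  refine ⟨_, .seq _ _ _ _ _ 1 5 (.add _ _ _ _ ?_) (.seq _ _ _ _ _ 1 4 (.add _ _ _ _ ?_)
    (.seq _ _ _ _ _ 1 3 (.add _ _ _ _ ?_) (.seq _ _ _ _ _ 1 2 (.add _ _ _ _ ?_)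
    (.seq _ _ _ _ _ 1 1 (.const _ _ _ ?_) (.add _ _ _ _ ?_))))), ?_, ?_, ?_⟩
  rotate_left 7
  · exact (((((h.setHidden 0 _ (by omega)).setHidden 0 _ (by omega)).setHidden 0 _
      (by omega)).setHidden 0 _ (by omega)).setHidden 8 _ (by omega)).setHidden 0 _ (by omega)
  · intro r h0 h8
    simp [State.setReg, h0, h8]
  all_goals (try simp [State.setReg, e, e2]); try omega

theorem Cmd.run {W : ℕ} {I : List ℕ} {n : ℕ} (c : Cmd) : ∀ {σ : State} {s : AState} {B : ℕ},
    Rel I n σ s → s.Bdd B → I.length + 8 * (B + c.size) + 8 ≤ W →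
    ∃ τ t, Exec W c.compile σ τ t ∧ t ≤ c.size ∧ Rel I n τ (c.sem s) ∧
      ∀ r, 5 ≤ r → r < 8 → τ.reg r = σ.reg r := by
  induction c with
  | zero r =>
    intro σ s B h hs hW
    exact ⟨_, _, .const _ _ _ (Nat.zero_le _), by simp [Cmd.size], h.setReg r 0,
      fun q h1 h2 => by simp only [State.setReg]; rw [Function.update_of_ne (by omega)]⟩
  | inc r =>
    intro σ s B h hs hW
    have := hs.1 r
    simp only [Cmd.size] at hW
    refine ⟨_, _, .add _ _ _ _ ?_, by simp [Cmd.size], ?_,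
      fun q h1 h2 => by simp only [State.setReg]; rw [Function.update_of_ne (by omega)]⟩
    · rw [h.regs, h.one]; omega
    · rw [h.regs, h.one]; exact h.setReg _ _
  | load r k q =>
    intro σ s B h hs hW
    simp only [Cmd.size] at hW
    obtain ⟨τ, hx, h0, hr, hf⟩ := Cmd.run_address h hs (W := W) (by omega) k q
    have := hs.2 k (s.reg q)
    refine ⟨_, _, .seq _ _ _ _ _ _ _ hx (.load _ _ _ ?_), by simp [Cmd.size], ?_, ?_⟩
    · rw [h0, hr.arrs]; omega
    · rw [h0, hr.arrs]; exact hr.setReg _ _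
    · intro p h1 h2
      simp only [State.setReg]
      rw [Function.update_of_ne (by omega), hf _ (by omega) (by omega)]
  | store k q r =>
    intro σ s B h hs hW
    simp only [Cmd.size] at hW
    obtain ⟨τ, hx, h0, hr, hf⟩ := Cmd.run_address h hs (W := W) (by omega) k q
    have := hs.1 r
    refine ⟨_, _, .seq _ _ _ _ _ _ _ hx (.store _ _ _ ?_), by simp [Cmd.size], ?_, ?_⟩
    · rw [hr.regs]; omega
    · rw [h0, hr.regs]; exact hr.setArr _ _ _
    · intro p h1 h2
      exact hf _ (by omega) (by omega)
  | seq c d hc hd =>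
    intro σ s B h hs hW
    simp only [Cmd.size] at hW
    obtain ⟨τ, t, hx, ht, hr, hf⟩ := hc h hs (by omega)
    obtain ⟨υ, u, hx', hu, hr', hf'⟩ := hd hr (c.bdd_sem hs) (by omega)
    exact ⟨υ, _, .seq _ _ _ _ _ _ _ hx hx', by simp only [Cmd.size]; omega, hr',
      fun r h1 h2 => (hf' r h1 h2).trans (hf r h1 h2)⟩
  | ite r q c d hc hd =>
    intro σ s B h hs hW
    simp only [Cmd.size] at hW
    simp only [Cmd.sem, Cmd.compile, Cmd.size]
    split_ifs with hlt
    · obtain ⟨τ, t, hx, ht, hr, hf⟩ := hc h hs (by omega)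
      exact ⟨τ, _, .branch_true _ _ _ _ _ _ _ (by rwa [h.regs, h.regs]) hx, by omega, hr, hf⟩
    · obtain ⟨τ, t, hx, ht, hr, hf⟩ := hd h hs (by omega)
      exact ⟨τ, _, .branch_false _ _ _ _ _ _ _ (by rwa [h.regs, h.regs]) hx, by omega, hr, hf⟩

/-- Commands for one vertex: loop-free commands and loops over the adjacency list. -/
inductive VCmd : Type
  | cmd (c : Cmd) : VCmd
  /-- Run `c` for each neighbour of the current vertex, put into abstract register `1`. -/
  | nbr (c : Cmd) : VCmd
  | seq (c d : VCmd) : VCmd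

namespace VCmd

/-- The effect of a command at a vertex with adjacency list `l`. -/
def sem (l : List ℕ) : VCmd → AState → AState
  | cmd c, s => c.sem s
  | nbr c, s => l.foldl (fun s y => c.sem (s.setReg 1 y)) s
  | seq c d, s => d.sem l (c.sem l s)

/-- A bound for running time and growth, for an adjacency list of length `d`. -/
def size (d : ℕ) : VCmd → ℕ
  | cmd c => c.size
  | nbr c => 5 + d * (c.size + 3)
  | seq c e => c.size d + e.size d

/-- Translation to machine programs. -/
def compile : VCmd → Prog
  | cmd c => c.compile
  | nbr c => .seq (.add 0 5 3) (.seq (.load 6 0) (.seq (.add 0 0 3) (.seq (.load 7 0)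
      (.loop 6 7 (.seq (.load 11 6) (.seq c.compile (.add 6 6 3)))))))
  | seq c d => .seq c.compile d.compile

end VCmd

/-- The input `I` holds `l` as the adjacency list of vertex `i`, with entries at most `n`. -/
structure ListAt (I : List ℕ) (n i : ℕ) (l : List ℕ) : Prop where
  lt : i + 2 < I.length
  finish : I.getD (i + 2) 0 = I.getD (i + 1) 0 + l.length
  finish_le : I.getD (i + 2) 0 ≤ I.length
  entry : ∀ j (h : j < l.length), I.getD (I.getD (i + 1) 0 + j) 0 = l[j]
  le : ∀ y ∈ l, y ≤ n

theorem VCmd.bdd_foldl {n : ℕ} (c : Cmd) : ∀ (l : List ℕ) {s : AState} {B : ℕ},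
    (∀ y ∈ l, y ≤ n) → s.Bdd B → n ≤ B →
    (l.foldl (fun s y => c.sem (s.setReg 1 y)) s).Bdd (B + l.length * c.size) := by
  intro l
  induction l with
  | nil => intro s B _ hs _; simpa using hs
  | cons y l ih =>
    intro s B hl hs hn
    have h1 : (c.sem (s.setReg 1 y)).Bdd (B + c.size) :=
      c.bdd_sem (hs.setReg ((hl y (by simp)).trans hn))
    refine (ih (fun z hz => hl z (by simp [hz])) h1 (by omega)).mono ?_
    simp only [List.length_cons]
    linarith [Nat.succ_mul l.length c.size]

theorem VCmd.bdd_sem {n : ℕ} {l : List ℕ} (hl : ∀ y ∈ l, y ≤ n) (c : VCmd) :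
    ∀ {s : AState} {B : ℕ}, s.Bdd B → n ≤ B → (c.sem l s).Bdd (B + c.size l.length) := by
  induction c with
  | cmd c => exact fun h _ => c.bdd_sem h
  | nbr c =>
    intro s B h hn
    refine (VCmd.bdd_foldl c l hl h hn).mono ?_
    simp only [VCmd.size, Nat.mul_add]
    omega
  | seq c d hc hd =>
    intro s B h hn
    exact (hd (hc h hn) (by omega)).mono (by simp only [VCmd.size]; omega)

/-- The loop over the rest `l` of an adjacency list, whose first entry is at the address in
machine register `6`. -/
theorem VCmd.run_loop {W : ℕ} {I : List ℕ} {n : ℕ} (c : Cmd) : ∀ (l : List ℕ) {σ : State}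
    {s : AState} {B : ℕ}, Rel I n σ s → s.Bdd B → n ≤ B →
    I.length + 8 * (B + l.length * c.size) + 8 ≤ W → (∀ y ∈ l, y ≤ n) →
    σ.reg 7 = σ.reg 6 + l.length → σ.reg 7 ≤ I.length →
    (∀ j (h : j < l.length), I.getD (σ.reg 6 + j) 0 = l[j]) →
    ∃ τ t, Exec W (.loop 6 7 (.seq (.load 11 6) (.seq c.compile (.add 6 6 3)))) σ τ t ∧
      t ≤ 1 + l.length * (c.size + 3) ∧
      Rel I n τ (l.foldl (fun s y => c.sem (s.setReg 1 y)) s) ∧ τ.reg 5 = σ.reg 5 := by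
  intro l
  induction l with
  | nil =>
    intro σ s B h _ _ _ _ h7 _ _
    exact ⟨σ, 1, .loop_false _ _ _ _ (by simp [h7]), by simp, h, rfl⟩
  | cons y l ih =>
    intro σ s B h hs hn hW hl h7 h7' hI
    simp only [List.length_cons] at hW h7
    have hW1 : (l.length + 1) * c.size = l.length * c.size + c.size := Nat.succ_mul _ _
    have hy : σ.mem (σ.reg 6) = y := by
      rw [h.input _ (by omega)]
      exact hI 0 (by simp)
    have hyn : y ≤ n := hl y (by simp)
    have h1 : Rel I n (σ.setReg 11 y) (s.setReg 1 y) := h.setReg 1 y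
    have hs1 : (s.setReg 1 y).Bdd B := hs.setReg (hyn.trans hn)
    obtain ⟨τ, t, hx, ht, hr, hf⟩ := c.run h1 hs1 (W := W) (by omega)
    have f6 : τ.reg 6 = σ.reg 6 := by
      rw [hf 6 (by omega) (by omega)]; simp [State.setReg, Function.update]
    have f7 : τ.reg 7 = σ.reg 7 := by
      rw [hf 7 (by omega) (by omega)]; simp [State.setReg, Function.update]
    have f5 : τ.reg 5 = σ.reg 5 := by
      rw [hf 5 (by omega) (by omega)]; simp [State.setReg, Function.update]
    have hr' : Rel I n (τ.setReg 6 (σ.reg 6 + 1)) (c.sem (s.setReg 1 y)) :=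
      hr.setHidden 6 _ (by omega)
    have g6 : (τ.setReg 6 (σ.reg 6 + 1)).reg 6 = σ.reg 6 + 1 := by simp [State.setReg]
    have g7 : (τ.setReg 6 (σ.reg 6 + 1)).reg 7 = σ.reg 7 := by
      simp [State.setReg, Function.update, f7]
    have g5 : (τ.setReg 6 (σ.reg 6 + 1)).reg 5 = σ.reg 5 := by
      simp [State.setReg, Function.update, f5]
    obtain ⟨υ, u, hx2, hu, hr2, hf2⟩ := ih hr' (c.bdd_sem hs1) (by omega) (by omega)
      (fun z hz => hl z (by simp [hz])) (by rw [g6, g7]; omega) (by rw [g7]; omega)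
      (fun j hj => by
        rw [g6]
        have := hI (j + 1) (by simp [hj])
        simp only [List.getElem_cons_succ] at this
        rw [← this]; congr 1; omega)
    refine ⟨υ, _, .loop_true _ _ _ _ _ _ (1 + (t + 1)) u (by omega)
      (.seq _ _ _ _ _ _ _ (.load _ _ _ (by omega)) (.seq _ _ _ τ _ _ _ (by rwa [hy]) ?_)) hx2,
      ?_, hr2, hf2.trans g5⟩
    · have := Exec.add (W := W) 6 6 3 τ (by rw [f6, hr.one]; omega)
      rwa [f6, hr.one] at this
    · simp only [List.length_cons]
      have : (l.length + 1) * (c.size + 3) = l.length * (c.size + 3) + (c.size + 3) :=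
        Nat.succ_mul _ _
      omega

theorem VCmd.run {W : ℕ} {I : List ℕ} {n i : ℕ} {l : List ℕ} (hl : ListAt I n i l) (c : VCmd) :
    ∀ {σ : State} {s : AState} {B : ℕ}, Rel I n σ s → s.Bdd B → n ≤ B →
    I.length + 8 * (B + c.size l.length) + 8 ≤ W → σ.reg 5 = i →
    ∃ τ t, Exec W c.compile σ τ t ∧ t ≤ c.size l.length ∧ Rel I n τ (c.sem l s) ∧
      τ.reg 5 = i := by
  induction c with
  | cmd c =>
    intro σ s B h hs _ hW h5
    obtain ⟨τ, t, hx, ht, hr, hf⟩ := c.run h hs hW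
    exact ⟨τ, t, hx, ht, hr, (hf 5 (by omega) (by omega)).trans h5⟩
  | nbr c =>
    intro σ s B h hs hn hW h5
    have hlt := hl.lt
    have h1 := h.input (i + 1) (by omega)
    have h2 := h.input (i + 2) (by omega)
    have hfin := hl.finish
    have hfin' := hl.finish_le
    have h3 := h.one
    simp only [VCmd.size, Nat.mul_add] at hW
    -- the state in which the loop is entered
    set σ₁ : State := (((σ.setReg 0 (i + 1)).setReg 6 (I.getD (i + 1) 0)).setReg 0
      (i + 2)).setReg 7 (I.getD (i + 2) 0) with hσ₁
    have hr₁ : Rel I n σ₁ s := (((h.setHidden 0 _ (by omega)).setHidden 6 _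
      (by omega)).setHidden 0 _ (by omega)).setHidden 7 _ (by omega)
    have g6 : σ₁.reg 6 = I.getD (i + 1) 0 := by simp [hσ₁, State.setReg]
    have g7 : σ₁.reg 7 = I.getD (i + 2) 0 := by simp [hσ₁, State.setReg]
    have g5 : σ₁.reg 5 = i := by simp [hσ₁, State.setReg, h5]
    obtain ⟨τ, t, hx, ht, hr, hf⟩ := VCmd.run_loop (W := W) c l hr₁ hs hn (by omega) hl.le
      (by omega) (by omega) (fun j hj => by rw [g6]; exact hl.entry j hj)
    refine ⟨τ, 1 + (1 + (1 + (1 + t))), .seq _ _ _ (σ.setReg 0 (i + 1)) _ _ _ ?_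
      (.seq _ _ _ ((σ.setReg 0 (i + 1)).setReg 6 (I.getD (i + 1) 0)) _ _ _ ?_
      (.seq _ _ _ (((σ.setReg 0 (i + 1)).setReg 6 (I.getD (i + 1) 0)).setReg 0 (i + 2)) _ _ _ ?_
      (.seq _ _ _ σ₁ _ _ _ ?_ hx))), by simp only [VCmd.size]; omega, hr, hf.trans g5⟩
    · have := Exec.add (W := W) 0 5 3 σ (by omega)
      rwa [h5, h3] at this
    · have := Exec.load (W := W) 6 0 (σ.setReg 0 (i + 1)) (by
        simp [State.setReg, h1] at *; omega)
      simpa [State.setReg, h1] using this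
    · have := Exec.add (W := W) 0 0 3 ((σ.setReg 0 (i + 1)).setReg 6 (I.getD (i + 1) 0)) (by
        simp [State.setReg, h3]; omega)
      simpa [State.setReg, h3] using this
    · have := Exec.load (W := W) 7 0 (((σ.setReg 0 (i + 1)).setReg 6
        (I.getD (i + 1) 0)).setReg 0 (i + 2)) (by
        simp [State.setReg, h2] at *; omega)
      simpa [State.setReg, h2, hσ₁] using this
  | seq c d hc hd =>
    intro σ s B h hs hn hW h5
    simp only [VCmd.size] at hW
    obtain ⟨τ, t, hx, ht, hr, hf⟩ := hc h hs hn (by omega) h5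
    obtain ⟨υ, u, hx', hu, hr', hf'⟩ := hd hr (c.bdd_sem hl.le hs hn) (by omega) (by omega) hf
    exact ⟨υ, _, .seq _ _ _ _ _ _ _ hx hx', by simp only [VCmd.size]; omega, hr', hf'⟩

theorem VCmd.size_le (c : VCmd) : ∃ K, ∀ d, c.size d ≤ K * (d + 1) := by
  induction c with
  | cmd c => exact ⟨c.size, fun d => by simp only [VCmd.size]; nlinarith⟩
  | nbr c => exact ⟨c.size + 8, fun d => by simp only [VCmd.size]; nlinarith⟩
  | seq c e hc he =>
    obtain ⟨K, hK⟩ := hc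
    obtain ⟨L, hL⟩ := he
    exact ⟨K + L, fun d => by
      simp only [VCmd.size, Nat.add_mul]; exact Nat.add_le_add (hK d) (hL d)⟩

namespace VCmd

/-- The effect of running a command at the vertices in `L`, one after the other; `nb` gives the
adjacency lists. -/
def semAll (nb : ℕ → List ℕ) (L : List ℕ) (c : VCmd) (s : AState) : AState :=
  L.foldl (fun s i => c.sem (nb i) (s.setReg 0 i)) s

/-- The corresponding bound for running time and growth. -/
def sizeAll (nb : ℕ → List ℕ) (L : List ℕ) (c : VCmd) : ℕ :=
  (L.map fun i => c.size (nb i).length + 3).sum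

/-- The machine program that runs a command at all vertices. -/
def compileAll (c : VCmd) : Prog :=
  .seq (.const 5 0) (.loop 5 1 (.seq (.add 10 5 4) (.seq c.compile (.add 5 5 3))))

theorem bdd_semAll {n : ℕ} {nb : ℕ → List ℕ} (hnb : ∀ i, ∀ y ∈ nb i, y ≤ n) (c : VCmd) :
    ∀ (L : List ℕ) {s : AState} {B : ℕ}, (∀ i ∈ L, i ≤ n) → s.Bdd B → n ≤ B →
    (c.semAll nb L s).Bdd (B + c.sizeAll nb L) := by
  intro L
  induction L with
  | nil => intro s B _ hs _; simpa [semAll, sizeAll] using hs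
  | cons i L ih =>
    intro s B hL hs hn
    have h1 : (c.sem (nb i) (s.setReg 0 i)).Bdd (B + c.size (nb i).length) :=
      c.bdd_sem (hnb i) (hs.setReg ((hL i (by simp)).trans hn)) hn
    refine (ih (fun z hz => hL z (by simp [hz])) h1 (by omega)).mono ?_
    simp only [sizeAll, List.map_cons, List.sum_cons]
    omega

/-- The outer loop, entered at vertex `i` with `k` vertices left. -/
theorem run_loopAll {W : ℕ} {I : List ℕ} {n : ℕ} {nb : ℕ → List ℕ}
    (hI : ∀ i < n, ListAt I n i (nb i)) (c : VCmd) : ∀ (k i : ℕ) {σ : State} {s : AState} {B : ℕ},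
    i + k = n → Rel I n σ s → s.Bdd B → n ≤ B →
    I.length + 8 * (B + c.sizeAll nb (List.range' i k)) + 8 ≤ W → σ.reg 5 = i →
    ∃ τ t, Exec W (.loop 5 1 (.seq (.add 10 5 4) (.seq c.compile (.add 5 5 3)))) σ τ t ∧
      t ≤ 1 + c.sizeAll nb (List.range' i k) ∧ Rel I n τ (c.semAll nb (List.range' i k) s) := by
  intro k
  induction k with
  | zero =>
    intro i σ s B hi h _ _ _ h5
    exact ⟨σ, 1, .loop_false _ _ _ _ (by rw [h5, h.count]; omega), by simp, h⟩
  | succ k ih =>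
    intro i σ s B hi h hs hn hW h5
    have hl := hI i (by omega)
    rw [List.range'_succ] at hW ⊢
    simp only [sizeAll, List.map_cons, List.sum_cons] at hW ⊢
    have h1 : Rel I n (σ.setReg 10 i) (s.setReg 0 i) := h.setReg 0 i
    have hs1 : (s.setReg 0 i).Bdd B := hs.setReg (by omega)
    obtain ⟨τ, t, hx, ht, hr, hf⟩ := c.run hl h1 hs1 hn (W := W) (by omega)
      (by simp [State.setReg, h5])
    have hr' : Rel I n (τ.setReg 5 (i + 1)) (c.sem (nb i) (s.setReg 0 i)) :=
      hr.setHidden 5 _ (by omega)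
    obtain ⟨υ, u, hx2, hu, hr2⟩ := ih (i + 1) (by omega) hr' (c.bdd_sem hl.le hs1 hn) (by omega)
      (by simp only [sizeAll]; omega) (by simp [State.setReg])
    simp only [sizeAll] at hu
    refine ⟨υ, _, .loop_true _ _ _ _ _ _ (1 + (t + 1)) u (by rw [h5, h.count]; omega)
      (.seq _ _ _ (σ.setReg 10 i) _ _ _ ?_ (.seq _ _ _ τ _ _ _ hx ?_)) hx2, by omega, hr2⟩
    · have := Exec.add (W := W) 10 5 4 σ (by rw [h5, h.zero]; omega)
      rwa [h5, h.zero] at this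
    · have := Exec.add (W := W) 5 5 3 τ (by rw [hf, hr.one]; omega)
      rwa [hf, hr.one] at this

theorem run_all {W : ℕ} {I : List ℕ} {n : ℕ} {nb : ℕ → List ℕ}
    (hI : ∀ i < n, ListAt I n i (nb i)) (c : VCmd) {σ : State} {s : AState} {B : ℕ}
    (h : Rel I n σ s) (hs : s.Bdd B) (hn : n ≤ B)
    (hW : I.length + 8 * (B + c.sizeAll nb (List.range n)) + 8 ≤ W) :
    ∃ τ t, Exec W c.compileAll σ τ t ∧ t ≤ 2 + c.sizeAll nb (List.range n) ∧
      Rel I n τ (c.semAll nb (List.range n) s) := by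
  rw [List.range_eq_range'] at *
  obtain ⟨τ, t, hx, ht, hr⟩ := run_loopAll hI c n 0 (by omega)
    (h.setHidden 5 0 (by omega)) hs hn hW (by simp [State.setReg])
  exact ⟨τ, _, .seq _ _ _ _ _ _ _ (.const _ _ _ (Nat.zero_le _)) hx, by omega, hr⟩

end VCmd

/-- An algorithm is a list of vertex commands; each is run at all vertices before the next one
starts. This is its effect. -/
def semList (nb : ℕ → List ℕ) (n : ℕ) (A : List VCmd) (s : AState) : AState :=
  A.foldl (fun s c => c.semAll nb (List.range n) s) s

/-- The machine program of an algorithm, with `Q` run at the end. -/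
def compileList (Q : Prog) (A : List VCmd) : Prog :=
  A.foldr (fun c P => .seq c.compileAll P) Q

/-- A bound for running time and growth of an algorithm. -/
def sizeList (nb : ℕ → List ℕ) (n : ℕ) (A : List VCmd) : ℕ :=
  (A.map fun c => 2 + c.sizeAll nb (List.range n)).sum

theorem run_list {W : ℕ} {I : List ℕ} {n : ℕ} {nb : ℕ → List ℕ}
    (hI : ∀ i < n, ListAt I n i (nb i)) (hnb : ∀ i, ∀ y ∈ nb i, y ≤ n) (r : ℕ) :
    ∀ (A : List VCmd) {σ : State} {s : AState} {B : ℕ}, Rel I n σ s → s.Bdd B → n ≤ B →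
    I.length + 8 * (B + sizeList nb n A) + 8 ≤ W →
    ∃ τ t, Exec W (compileList (.add 0 (r + 10) 4) A) σ τ t ∧ t ≤ 1 + sizeList nb n A ∧
      τ.reg 0 = (semList nb n A s).reg r := by
  intro A
  induction A with
  | nil =>
    intro σ s B h hs _ hW
    have := hs.1 r
    refine ⟨_, 1, .add _ _ _ _ ?_, by simp, ?_⟩
    · rw [h.regs, h.zero]; omega
    · simp [State.setReg, h.regs, h.zero, semList]
  | cons c A ih =>
    intro σ s B h hs hn hW
    simp only [sizeList, List.map_cons, List.sum_cons] at hW ⊢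
    obtain ⟨τ, t, hx, ht, hr⟩ := c.run_all hI h hs hn (W := W) (by omega)
    obtain ⟨υ, u, hx2, hu, hr2⟩ := ih hr
      (c.bdd_semAll hnb _ (fun i hi => (List.mem_range.1 hi).le) hs hn) (by omega)
      (by simp only [sizeList]; omega)
    simp only [sizeList] at hu
    exact ⟨υ, _, .seq _ _ _ _ _ _ _ hx hx2, by omega, hr2⟩

theorem sizeList_le (A : List VCmd) : ∃ K, ∀ (nb : ℕ → List ℕ) (n : ℕ), 0 < n →
    sizeList nb n A ≤ K * (n + ((List.range n).map fun i => (nb i).length).sum) := by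
  have key : ∀ c : VCmd, ∃ K, ∀ (nb : ℕ → List ℕ) (L : List ℕ), c.sizeAll nb L ≤
      K * (L.length + (L.map fun i => (nb i).length).sum) := by
    intro c
    obtain ⟨K, hK⟩ := c.size_le
    refine ⟨K + 3, fun nb L => ?_⟩
    induction L with
    | nil => simp [VCmd.sizeAll]
    | cons i L ih =>
      simp only [VCmd.sizeAll, List.map_cons, List.sum_cons, List.length_cons] at *
      have := hK (nb i).length
      nlinarith
  induction A with
  | nil => exact ⟨0, fun nb n _ => by simp [sizeList]⟩
  | cons c A ih =>
    obtain ⟨K, hK⟩ := key c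
    obtain ⟨L, hL⟩ := ih
    refine ⟨2 + K + L, fun nb n hn => ?_⟩
    have h1 := hK nb (List.range n)
    have h2 := hL nb n hn
    simp only [sizeList, List.map_cons, List.sum_cons, List.length_range] at *
    rw [Nat.add_mul, Nat.add_mul]
    have h3 : 2 * 1 ≤ 2 * (n + ((List.range n).map fun i => (nb i).length).sum) :=
      Nat.mul_le_mul_left 2 (by omega)
    omega

/-! ### The input -/

/-- The adjacency list of the vertex with number `i`, as a list of numbers. -/
def nbrs {n : ℕ} (adj : Fin n → List (Fin n)) (i : ℕ) : List ℕ :=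
  (rows adj).getD i []

theorem nbrs_val {n : ℕ} (adj : Fin n → List (Fin n)) (v : Fin n) :
    nbrs adj v = (adj v).map Fin.val := by
  simp [nbrs, rows, List.getD]

theorem nbrs_le {n : ℕ} (adj : Fin n → List (Fin n)) (i : ℕ) : ∀ y ∈ nbrs adj i, y ≤ n := by
  intro y hy
  by_cases hi : i < n
  · rw [show i = ((⟨i, hi⟩ : Fin n) : ℕ) from rfl, nbrs_val] at hy
    obtain ⟨z, _, rfl⟩ := List.mem_map.1 hy
    exact z.isLt.le
  · simp [nbrs, rows, List.getD, hi] at hy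

theorem length_encode {n : ℕ} (adj : Fin n → List (Fin n)) :
    (encode adj).length = n + 2 + (rows adj).flatten.length := by
  simp only [encode, List.length_cons, List.length_append, List.length_map, List.length_range]
  omega

theorem encode_pointer {n : ℕ} (adj : Fin n → List (Fin n)) {i : ℕ} (hi : i ≤ n) :
    (encode adj).getD (i + 1) 0 = n + 2 + ((rows adj).take i).flatten.length := by
  have h : i < ((List.range (n + 1)).map
      (fun v => n + 2 + ((rows adj).take v).flatten.length)).length := by simp; omega
  simp only [encode, List.getD_cons_succ]
  rw [List.getD_append _ _ _ _ h, List.getD_eq_getElem _ _ h]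
  simp

theorem encode_entry {n : ℕ} (adj : Fin n → List (Fin n)) (j : ℕ) :
    (encode adj).getD (n + 2 + j) 0 = (rows adj).flatten.getD j 0 := by
  rw [show n + 2 + j = (n + 1 + j) + 1 by omega]
  simp only [encode, List.getD_cons_succ]
  rw [List.getD_append_right _ _ _ _ (by simp)]
  congr 1
  simp

theorem listAt_encode {n : ℕ} (adj : Fin n → List (Fin n)) {i : ℕ} (hi : i < n) :
    ListAt (encode adj) n i (nbrs adj i) := by
  have hlen : (rows adj).length = n := by simp [rows]
  have hi' : i < (rows adj).length := by omega
  have hnb : nbrs adj i = (rows adj)[i] := by simp [nbrs, List.getD, hi']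
  have htake : ((rows adj).take (i + 1)).flatten.length =
      ((rows adj).take i).flatten.length + (nbrs adj i).length := by
    rw [List.take_succ_eq_append_getElem hi', hnb, List.flatten_append, List.length_append]; simp
  have hsplit : (rows adj).flatten =
      ((rows adj).take i).flatten ++ (nbrs adj i ++ ((rows adj).drop (i + 1)).flatten) := by
    conv_lhs => rw [← List.take_append_drop i (rows adj), List.drop_eq_getElem_cons hi', List.flatten_append, List.flatten_cons, ← hnb]
  have hp := encode_pointer adj hi.le
  have hp' : (encode adj).getD (i + 2) 0 = _ := encode_pointer adj (i := i + 1) hi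
  have hL := length_encode adj
  have hsl := congrArg List.length hsplit
  simp only [List.length_append] at hsl
  refine ⟨by omega, by omega, by omega, fun j hj => ?_, nbrs_le adj i⟩
  rw [hp, Nat.add_assoc, encode_entry, hsplit, List.getD_append_right _ _ _ _ (by omega),
    List.getD_append _ _ _ _ (by omega), List.getD_eq_getElem _ _ (by omega)]
  congr 1
  omega

/-- Load the number of vertices and the length of the input. -/
def prologue : Prog :=
  .seq (.const 3 1) (.seq (.load 1 0) (.seq (.add 0 1 3) (.load 2 0)))

/-- The initial abstract state. -/
def AState.init : AState := ⟨fun _ => 0, fun _ _ => 0⟩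

theorem run_prologue {n W : ℕ} (adj : Fin n → List (Fin n)) (hW : (encode adj).length ≤ W) :
    ∃ σ, Exec W prologue (initState (encode adj)) σ 4 ∧ Rel (encode adj) n σ .init := by
  have h0 : (encode adj).getD 0 0 = n := by simp [encode]
  have hl := length_encode adj
  have h1 : (encode adj).getD (n + 1) 0 = (encode adj).length := by
    rw [encode_pointer adj le_rfl, hl, List.take_of_length_le (by simp [rows])]
  set σ := initState (encode adj)
  set σ₁ := σ.setReg 3 1 with e₁
  set σ₂ := σ₁.setReg 1 n with e₂
  set σ₃ := σ₂.setReg 0 (n + 1) with e₃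
  have h2 : Exec W (.load 1 0) σ₁ σ₂ 1 := by
    have e : σ₁.mem (σ₁.reg 0) = n := h0
    have := Exec.load (W := W) 1 0 σ₁ (by omega)
    rwa [e] at this
  have h3 : Exec W (.add 0 1 3) σ₂ σ₃ 1 := by
    have e : σ₂.reg 1 = n := rfl
    have e' : σ₂.reg 3 = 1 := rfl
    have := Exec.add (W := W) 0 1 3 σ₂ (by omega)
    rwa [e, e'] at this
  have h4 : Exec W (.load 2 0) σ₃ (σ₃.setReg 2 (encode adj).length) 1 := by
    have e : σ₃.mem (σ₃.reg 0) = (encode adj).length := h1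
    have := Exec.load (W := W) 2 0 σ₃ (by omega)
    rwa [e] at this
  refine ⟨_, .seq _ _ _ _ _ 1 3 (.const _ _ _ (by omega)) (.seq _ _ _ _ _ 1 2 h2
    (.seq _ _ _ _ _ 1 1 h3 h4)), fun r => ?_, fun k v => ?_, fun a _ => rfl, rfl, rfl, rfl, rfl⟩
  · simp [AState.init, e₁, e₂, e₃, σ, State.setReg, initState]
  · simp [AState.init, e₁, e₂, e₃, σ, State.setReg, initState, Nat.add_assoc]

theorem sum_length_nbrs {n : ℕ} (adj : Fin n → List (Fin n)) :
    ((List.range n).map fun i => (nbrs adj i).length).sum = (rows adj).flatten.length := by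
  rw [List.length_flatten]
  congr 1
  refine List.ext_getElem (by simp [rows]) fun i h1 h2 => ?_
  have hi : i < n := by simpa using h1
  have := nbrs_val adj ⟨i, hi⟩
  simp only [List.getElem_map, List.getElem_range]
  simp [this, rows]

theorem length_flatten_rows {n : ℕ} {G : SimpleGraph (Fin n)} {adj : Fin n → List (Fin n)}
    (h : IsAdjList G adj) : (rows adj).flatten.length = 2 * G.edgeSet.ncard := by
  classical
  have h1 : ∀ v, (adj v).length = G.degree v := fun v => by
    rw [← List.toFinset_card_of_nodup (h v).1, ← SimpleGraph.card_neighborFinset_eq_degree]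
    congr 1
    ext w
    simp [(h v).2]
  have h2 : (rows adj).flatten.length = ∑ v, (adj v).length := by
    simp [rows, List.map_ofFn, List.sum_ofFn]
  rw [h2, Finset.sum_congr rfl fun v _ => h1 v, SimpleGraph.sum_degrees_eq_twice_card_edges,
    ← SimpleGraph.coe_edgeFinset, Set.ncard_coe_finset]

/-- Every algorithm of the structured language runs in linear time, with words of logarithmic
length. The result is the content of abstract register `r`. -/
theorem exists_program (A : List VCmd) (r : ℕ) : ∃ (P : Prog) (c : ℕ),
    ∀ (n : ℕ) (G : SimpleGraph (Fin n)) (adj : Fin n → List (Fin n)), 0 < n → IsAdjList G adj →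
      ∃ (σ : State) (t : ℕ),
        Exec (c * (n + G.edgeSet.ncard)) P (initState (encode adj)) σ t ∧
        t ≤ c * (n + G.edgeSet.ncard) ∧
        σ.reg 0 = (semList (nbrs adj) n A .init).reg r := by
  obtain ⟨K, hK⟩ := sizeList_le A
  refine ⟨.seq prologue (compileList (.add 0 (r + 10) 4) A), 16 * K + 30,
    fun n G adj hn hadj => ?_⟩
  have h1 := hK (nbrs adj) n hn
  have h2 := length_encode adj
  rw [sum_length_nbrs, length_flatten_rows hadj] at h1
  rw [length_flatten_rows hadj] at h2
  set m := G.edgeSet.ncard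
  have h3 : sizeList (nbrs adj) n A ≤ 2 * (K * (n + m)) := by
    refine h1.trans ?_
    rw [Nat.mul_add, Nat.mul_add, ← mul_assoc K 2 m, mul_comm K 2, mul_assoc 2 K m]
    omega
  have h4 : (16 * K + 30) * (n + m) = 16 * (K * (n + m)) + 30 * (n + m) := by ring
  have h5 : 0 ≤ K * (n + m) := Nat.zero_le _
  obtain ⟨σ, hx, hr⟩ := run_prologue adj (W := (16 * K + 30) * (n + m)) (by omega)
  obtain ⟨τ, t, hx', ht, hres⟩ := run_list (W := (16 * K + 30) * (n + m)) (B := n)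
    (fun i hi => listAt_encode adj hi) (nbrs_le adj) r A hr
    ⟨fun _ => Nat.zero_le _, fun _ _ => Nat.zero_le _⟩ le_rfl (by omega)
  exact ⟨τ, _, .seq _ _ _ _ _ _ _ hx hx', by omega, hres⟩

/-! ### Convex sets and hull sets -/

section Convexity

variable {V : Type*} {G : SimpleGraph V}

theorem isConvex_iff {C : Set V} : IsConvex G C ↔ ∀ v ∉ C, ∀ (a b : V) (ha : a ∈ C) (hb : b ∈ C),
    a ≠ b → G.Adj v a → G.Adj v b → ¬ (G.induce C).Reachable ⟨a, ha⟩ ⟨b, hb⟩ := by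
  constructor
  · intro h v hv a b ha hb hab hva hvb hr
    obtain ⟨p, hp⟩ := hr.exists_isPath
    -- the path from `a` to `b` in `C`, closed up through `v`
    let q : G.Walk a b := p.map (SimpleGraph.Embedding.induce C).toHom
    have hq : q.IsPath := hp.map (SimpleGraph.Embedding.induce (G := G) C).injective
    have hsupp : ∀ w ∈ q.support, w ∈ C := by
      intro w hw
      rw [show q.support = _ from SimpleGraph.Walk.support_map _ _] at hw
      obtain ⟨z, _, rfl⟩ := List.mem_map.1 hw
      exact z.2
    have hvq : v ∉ q.support := fun hw => hv (hsupp v hw)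
    refine hv (h ▸ Or.inr ⟨.cons hva (q.concat hvb.symm), ?_, ?_⟩)
    · rw [SimpleGraph.Walk.cons_isCycle_iff]
      refine ⟨hq.concat hvq hvb.symm, fun he => ?_⟩
      rw [SimpleGraph.Walk.edges_concat, List.concat_eq_append, List.mem_append] at he
      rcases he with he | he
      · exact hvq (q.fst_mem_support_of_mem_edges he)
      · simp only [List.mem_singleton, Sym2.eq_iff] at he
        rcases he with ⟨h1, _⟩ | ⟨_, h1⟩
        · exact hv (h1 ▸ hb)
        · exact hab h1
    · intro w hw
      simp only [SimpleGraph.Walk.support_cons, SimpleGraph.Walk.support_concat,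
        List.mem_cons, List.mem_append, List.not_mem_nil, or_false] at hw
      rcases hw with rfl | hw | rfl
      · exact Or.inl rfl
      · exact Or.inr (hsupp w hw)
      · exact Or.inl rfl
  · intro h
    refine Set.union_eq_self_of_subset_right ?_
    rintro v ⟨c, hc, hsupp⟩
    by_contra hv
    cases c with
    | nil => exact hc.ne_nil rfl
    | @cons _ a _ hva p =>
      rw [SimpleGraph.Walk.cons_isCycle_iff] at hc
      obtain ⟨hp, he⟩ := hc
      have hpr := hp.reverse
      have hs : ∀ w ∈ p.reverse.support, w ∈ insert v C := fun w hw =>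
        hsupp w (by simpa using Or.inr hw)
      have her : s(v, a) ∉ p.reverse.edges := by simpa using he
      generalize p.reverse = q at hpr hs her
      cases q with
      | nil => exact hva.ne rfl
      | @cons _ b _ hvb q =>
        rw [SimpleGraph.Walk.cons_isPath_iff] at hpr
        have hq : ∀ w ∈ q.support, w ∈ C := by
          intro w hw
          rcases hs w (by simp [hw]) with rfl | hw'
          · exact absurd hw hpr.2
          · exact hw'
        refine h v hv b a (hq b q.start_mem_support) (hq a q.end_mem_support) ?_ hvb hva
          ⟨q.induce C hq⟩
        rintro rfl
        simp at her

theorem isHullSet_iff {S : Set V} :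
    IsHullSet G S ↔ ∀ C, IsConvex G C → S ⊆ C → C = Set.univ := by
  simp [IsHullSet, hull, Set.sInter_eq_univ]

/-- A property that passes to neighbours passes along walks. -/
theorem of_reachable {P : V → Prop} (hP : ∀ x y, G.Adj x y → P x → P y) {v w : V}
    (h : G.Reachable v w) (hv : P v) : P w := by
  obtain ⟨p⟩ := h
  induction p with
  | nil => exact hv
  | cons hadj _ ih => exact ih (hP _ _ hadj hv)

/-- In a nontrivial connected set every vertex has a neighbour. -/
theorem exists_adj_of_reachable {v w : V} (h : G.Reachable v w) (hne : v ≠ w) :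
    ∃ z, G.Adj v z := by
  obtain ⟨p⟩ := h
  cases p with
  | nil => exact absurd rfl hne
  | cons hadj _ => exact ⟨_, hadj⟩

/-- If a hull set `S` meets a union `X` of components in so few vertices that no vertex of `X`
outside `S` has two neighbours in `S` which themselves have neighbours in `S`, then `S ⊇ X`. -/
theorem IsHullSet.subset_of {S X : Set V} (hS : IsHullSet G S)
    (hX : ∀ v w, G.Adj v w → v ∈ X → w ∈ X)
    (h : ∀ v ∈ X, v ∉ S → ∀ a ∈ X, a ∈ S → ∀ b ∈ X, b ∈ S → a ≠ b → G.Adj v a → G.Adj v b →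
      (∃ z ∈ X, z ∈ S ∧ G.Adj a z) → (∃ z ∈ X, z ∈ S ∧ G.Adj b z) → False) : X ⊆ S := by
  have hconv : IsConvex G (S ∪ Xᶜ) := by
    rw [isConvex_iff]
    intro v hv a b ha hb hab hva hvb hr
    simp only [Set.mem_union, Set.mem_compl_iff, not_or, not_not] at hv
    have haX := hX _ _ hva hv.2
    have hbX := hX _ _ hvb hv.2
    have key : ∀ (x y : V) (hx : x ∈ S ∪ Xᶜ) (hy : y ∈ S ∪ Xᶜ), x ∈ X → x ≠ y →
        (G.induce (S ∪ Xᶜ)).Reachable ⟨x, hx⟩ ⟨y, hy⟩ → ∃ z ∈ X, z ∈ S ∧ G.Adj x z := by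
      intro x y hx hy hxX hxy hr
      obtain ⟨⟨z, hz⟩, hxz⟩ := exists_adj_of_reachable hr (by simpa using hxy)
      have hxz : G.Adj x z := hxz
      have hzX := hX _ _ hxz hxX
      exact ⟨z, hzX, hz.resolve_right (by simpa using hzX), hxz⟩
    exact h v hv.2 hv.1 a haX (ha.resolve_right (by simpa using haX)) b hbX
      (hb.resolve_right (by simpa using hbX)) hab hva hvb (key a b ha hb haX hab hr)
      (key b a hb ha hbX hab.symm hr.symm)
  have huniv := isHullSet_iff.1 hS _ hconv Set.subset_union_left
  intro v hv
  have : v ∈ S ∪ Xᶜ := huniv ▸ Set.mem_univ v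
  exact this.resolve_right (by simpa using hv)

/-- A hull set meets every nonempty set whose vertices have at most one neighbour outside. -/
theorem IsHullSet.exists_mem {S Z : Set V} (hS : IsHullSet G S) {v : V} (hv : v ∈ Z)
    (h : ∀ x ∈ Z, ∀ a ∉ Z, ∀ b ∉ Z, G.Adj x a → G.Adj x b → a = b) : ∃ s ∈ S, s ∈ Z := by
  by_contra! hcon
  have hconv : IsConvex G Zᶜ := by
    rw [isConvex_iff]
    intro x hx a b ha hb hab hxa hxb _
    exact hab (h x (by simpa using hx) a ha b hb hxa hxb)
  have := isHullSet_iff.1 hS _ hconv fun s hs => hcon s hs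
  exact (this ▸ Set.mem_univ v : v ∈ Zᶜ) hv

/-! ### Induced paths on four vertices -/

/-- `a, b, c, d` is an induced path. -/
def IsP4 (G : SimpleGraph V) (a b c d : V) : Prop :=
  G.Adj a b ∧ G.Adj b c ∧ G.Adj c d ∧ ¬ G.Adj a c ∧ ¬ G.Adj a d ∧ ¬ G.Adj b d

theorem IsP4.inducesP4 [DecidableEq V] {a b c d : V} (h : IsP4 G a b c d) :
    InducesP4 G ({a, b, c, d} : Finset V) := by
  obtain ⟨hab, hbc, hcd, hac, had, hbd⟩ := h
  have h1 := hab.ne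
  have h2 := hbc.ne
  have h3 := hcd.ne
  have h4 : a ≠ c := by rintro rfl; exact had hcd
  have h5 : a ≠ d := by rintro rfl; exact hac hcd.symm
  have h6 : b ≠ d := by rintro rfl; exact had hab
  have hca : ¬ G.Adj c a := fun h => hac h.symm
  have hda : ¬ G.Adj d a := fun h => had h.symm
  have hdb : ¬ G.Adj d b := fun h => hbd h.symm
  let f : Fin 4 → (({a, b, c, d} : Finset V) : Set V) :=
    ![⟨a, by simp⟩, ⟨b, by simp⟩, ⟨c, by simp⟩, ⟨d, by simp⟩]
  have hf : Function.Bijective f := by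
    constructor
    · intro i j hij
      fin_cases i <;> fin_cases j <;> simp_all [f]
    · rintro ⟨x, hx⟩
      simp only [Finset.coe_insert, Finset.coe_singleton, Set.mem_insert_iff,
        Set.mem_singleton_iff] at hx
      rcases hx with rfl | rfl | rfl | rfl
      exacts [⟨0, rfl⟩, ⟨1, rfl⟩, ⟨2, rfl⟩, ⟨3, rfl⟩]
  refine ⟨(⟨Equiv.ofBijective f hf, ?_⟩ : SimpleGraph.pathGraph 4 ≃g _).symm⟩
  intro i j
  rw [SimpleGraph.pathGraph_adj]
  fin_cases i <;> fin_cases j <;>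
    simp [f, hab, hbc, hcd, hac, had, hbd, hab.symm, hbc.symm, hcd.symm,
      hca, hda, hdb]

/-- Two induced paths on four vertices do not live on the same five vertices `a, b, c, d, e`, if
the first one avoids `e` and the second one does not. -/
theorem IsP4Sparse.elim (hG : IsP4Sparse G) {a b c d e a' b' c' d' : V} (h : IsP4 G a b c d)
    (h' : IsP4 G a' b' c' d') (ha : e ≠ a) (hb : e ≠ b) (hc : e ≠ c) (hd : e ≠ d)
    (he : e = a' ∨ e = b' ∨ e = c' ∨ e = d')
    (hsub : ∀ x, (x = a' ∨ x = b' ∨ x = c' ∨ x = d') → x = a ∨ x = b ∨ x = c ∨ x = d ∨ x = e) :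
    False := by
  classical
  have hP := h.inducesP4
  have hcard : ({a, b, c, d} : Finset V).card = 4 := by
    obtain ⟨f⟩ := hP
    have := Fintype.card_congr f.toEquiv
    simpa using this
  have hnot : e ∉ ({a, b, c, d} : Finset V) := by simp [ha, hb, hc, hd]
  have := hG (insert e {a, b, c, d}) (by rw [Finset.card_insert_of_notMem hnot, hcard])
    {a, b, c, d} {a', b', c', d'} (Finset.subset_insert _ _) (fun x hx => by
      simp only [Finset.mem_insert, Finset.mem_singleton] at hx ⊢
      have := hsub x hx
      tauto) hP h'.inducesP4
  exact hnot (this ▸ by simpa using he)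

/-! ### Connected sets without attached leaves -/

/-- `v` has exactly one neighbour. -/
def IsLeaf (G : SimpleGraph V) (v : V) : Prop :=
  ∃ w, G.Adj v w ∧ ∀ z, G.Adj v z → z = w

/-- `v` is adjacent to all other vertices of its component. -/
def Dominates (G : SimpleGraph V) (v : V) : Prop :=
  ∀ w, G.Reachable v w → w = v ∨ G.Adj v w

theorem exists_adj_ne {v a : V} (h : ¬ IsLeaf G v) (ha : G.Adj v a) : ∃ z, G.Adj v z ∧ z ≠ a := by
  by_contra! hcon
  exact h ⟨a, ha, hcon⟩

/-- A vertex that does not dominate its component has a vertex at distance two. -/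
theorem exists_distance_two {v : V} (h : ¬ Dominates G v) :
    ∃ y z, G.Adj v y ∧ G.Adj y z ∧ z ≠ v ∧ ¬ G.Adj v z := by
  by_contra! hcon
  refine h fun w hw => of_reachable (P := fun w => w = v ∨ G.Adj v w) ?_ hw (Or.inl rfl)
  rintro x y hxy (rfl | hx)
  · exact Or.inr hxy
  · by_cases hy : y = v
    · exact Or.inl hy
    · exact Or.inr (hcon x y hx hxy hy)

/-- Let `D` be a connected set with at least three vertices in a `P₄`-sparse graph, such that
every outside vertex has at most one neighbour in `D`, no leaf is attached to `D` from outside,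
and no vertex of `D` dominates its component. Then `D` is a union of components. -/
theorem IsP4Sparse.closed_of_connected (hG : IsP4Sparse G) {D : Set V}
    (hconn : ∀ Q : Set V, ∀ a ∈ D, a ∈ Q →
      (∀ x ∈ D, ∀ y ∈ D, G.Adj x y → x ∈ Q → y ∈ Q) → D ⊆ Q)
    (huniq : ∀ v ∉ D, ∀ a ∈ D, ∀ b ∈ D, G.Adj v a → G.Adj v b → a = b)
    (hthree : ∀ a b : V, ∃ e ∈ D, e ≠ a ∧ e ≠ b)
    (hleaf : ∀ v ∉ D, ∀ a ∈ D, G.Adj v a → ¬ IsLeaf G v)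
    (hdom : ∀ a ∈ D, ¬ Dominates G a) {a v : V} (ha : a ∈ D) (hav : G.Adj a v) : v ∈ D := by
  have ne : ∀ {x y}, x ∈ D → y ∉ D → x ≠ y := fun hx hy e => hy (e ▸ hx)
  have sy : ∀ {x y}, ¬ G.Adj x y → ¬ G.Adj y x := fun h h' => h h'.symm
  have nadj : ∀ {x a b}, x ∉ D → a ∈ D → b ∈ D → a ≠ b → G.Adj x a → ¬ G.Adj x b :=
    fun hx ha hb hab h h' => hab (huniq _ hx _ ha _ hb h h')
  -- a vertex of `D` with a neighbour outside `D` is adjacent to all of `D`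
  have hall : ∀ a ∈ D, ∀ v ∉ D, G.Adj a v → ∀ d ∈ D, d ≠ a → G.Adj a d := by
    intro a ha v hv hav d hd hda
    have hsub := hconn {x | x = a ∨ G.Adj a x} a ha (Or.inl rfl)
    by_contra hnd
    have : ∃ e ∈ D, ∃ d ∈ D, G.Adj a e ∧ G.Adj e d ∧ d ≠ a ∧ ¬ G.Adj a d := by
      by_contra! hcon
      refine hnd ((hsub ?_ hd).resolve_left hda)
      rintro x hx y hy hxy (rfl | hax)
      · exact Or.inr hxy
      · by_cases hya : y = a
        · exact Or.inl hya
        · exact Or.inr (hcon x hx y hy hax hxy hya)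
    obtain ⟨e, he, d, hd, hae, hed, hda, hnd⟩ := this
    have hve := nadj hv ha he hae.ne hav.symm
    have hvd := nadj hv ha hd hda.symm hav.symm
    obtain ⟨z, hvz, hza⟩ := exists_adj_ne (hleaf v hv a ha hav.symm) hav.symm
    have hz : z ∉ D := fun hz => hza (huniq v hv z hz a ha hvz hav.symm)
    have h1 : IsP4 G v a e d := ⟨hav.symm, hae, hed, hve, hvd, hnd⟩
    by_cases hza' : G.Adj z a
    · exact hG.elim (e := z) h1 (a' := z) (b' := a) (c' := e) (d' := d)
        ⟨hza', hae, hed, nadj hz ha he hae.ne hza', nadj hz ha hd hda.symm hza', hnd⟩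
        hvz.ne' hza (ne he hz).symm (ne hd hz).symm (by tauto) (by tauto)
    · by_cases hze : G.Adj z e
      · exact hG.elim (e := z) h1 (a' := v) (b' := z) (c' := e) (d' := d)
          ⟨hvz, hze, hed, hve, hvd, nadj hz he hd hed.ne hze⟩
          hvz.ne' hza (ne he hz).symm (ne hd hz).symm (by tauto) (by tauto)
      · exact hG.elim (e := z) h1 (a' := z) (b' := v) (c' := a) (d' := e)
          ⟨hvz.symm, hav.symm, hae, hza', hze, hve⟩
          hvz.ne' hza (ne he hz).symm (ne hd hz).symm (by tauto) (by tauto)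
  -- so nothing at distance two from `a` is reached through an outside neighbour of `a`
  have hfar : ∀ a ∈ D, ∀ y ∉ D, G.Adj a y → ∀ z ∉ D, G.Adj y z → ¬ G.Adj a z → False := by
    intro a ha y hy hay z hz hyz haz
    have key : ∀ d₁ ∈ D, ∀ d₂ ∈ D, d₁ ≠ a → d₂ ≠ a → d₁ ≠ d₂ → ¬ G.Adj z d₂ → False := by
      intro d₁ hd₁ d₂ hd₂ h1 h2 h12 hzd₂
      have had₁ := hall a ha y hy hay d₁ hd₁ h1
      have had₂ := hall a ha y hy hay d₂ hd₂ h2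
      have hyd₁ := nadj hy ha hd₁ h1.symm hay.symm
      have hyd₂ := nadj hy ha hd₂ h2.symm hay.symm
      have hP : IsP4 G z y a d₂ := ⟨hyz.symm, hay.symm, had₂, sy haz, hzd₂, hyd₂⟩
      by_cases hzd₁ : G.Adj z d₁
      · exact hG.elim (e := d₁) hP (a' := y) (b' := z) (c' := d₁) (d' := d₂)
          ⟨hyz, hzd₁, hall d₁ hd₁ z hz hzd₁.symm d₂ hd₂ h12.symm, hyd₁, hyd₂, hzd₂⟩
          (ne hd₁ hz) (ne hd₁ hy) h1 h12 (by tauto) (by tauto)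
      · exact hG.elim (e := d₁) hP (a' := z) (b' := y) (c' := a) (d' := d₁)
          ⟨hyz.symm, hay.symm, had₁, sy haz, hzd₁, hyd₁⟩
          (ne hd₁ hz) (ne hd₁ hy) h1 h12 (by tauto) (by tauto)
    obtain ⟨d₁, hd₁, h1, -⟩ := hthree a a
    obtain ⟨d₂, hd₂, h2, h12⟩ := hthree a d₁
    by_cases hzd₂ : G.Adj z d₂
    · exact key d₂ hd₂ d₁ hd₁ h2 h1 h12 (nadj hz hd₂ hd₁ h12 hzd₂)
    · exact key d₁ hd₁ d₂ hd₂ h1 h2 h12.symm hzd₂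
  by_contra hv
  obtain ⟨b, z, hab, hbz, hza, haz⟩ := exists_distance_two (hdom a ha)
  have hz : z ∉ D := fun hz => haz (hall a ha v hv hav z hz hza)
  by_cases hb : b ∈ D
  · obtain ⟨y, hzy, hyb⟩ := exists_adj_ne (hleaf z hz b hb hbz.symm) hbz.symm
    have hy : y ∉ D := fun hy => hyb (huniq z hz y hy b hb hzy hbz.symm)
    have hvb := nadj hv ha hb hab.ne hav.symm
    by_cases hvz : G.Adj v z
    · exact hfar a ha v hv hav z hz hvz haz
    by_cases hay : G.Adj a y
    · exact hfar a ha y hy hay z hz hzy.symm haz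
    have hP : IsP4 G v a b z := ⟨hav.symm, hab, hbz, hvb, hvz, haz⟩
    have hyv : y ≠ v := by rintro rfl; exact hay hav
    by_cases hvy : G.Adj v y
    · exact hG.elim (e := y) hP (a' := a) (b' := v) (c' := y) (d' := z)
        ⟨hav, hvy, hzy.symm, hay, haz, hvz⟩
        hyv (ne ha hy).symm (ne hb hy).symm hzy.ne' (by tauto) (by tauto)
    · by_cases hyb' : G.Adj y b
      · exact hG.elim (e := y) hP (a' := y) (b' := b) (c' := a) (d' := v)
          ⟨hyb', hab.symm, hav, sy hay, sy hvy, sy hvb⟩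
          hyv (ne ha hy).symm (ne hb hy).symm hzy.ne' (by tauto) (by tauto)
      · exact hG.elim (e := y) hP (a' := y) (b' := z) (c' := b) (d' := a)
          ⟨hzy.symm, hbz.symm, hab.symm, hyb', sy hay, sy haz⟩
          hyv (ne ha hy).symm (ne hb hy).symm hzy.ne' (by tauto) (by tauto)
  · exact hfar a ha b hb hab z hz hbz haz

/-- In a component without a dominating vertex of a `P₄`-sparse graph, a convex set that contains
all leaves and a path on three vertices contains the component. -/
theorem IsP4Sparse.subset_of_isConvex (hG : IsP4Sparse G) {C : Set V} (hC : IsConvex G C)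
    {x y z : V} (hdom : ∀ v, G.Reachable y v → ¬ Dominates G v)
    (hleaf : ∀ v, G.Reachable y v → IsLeaf G v → v ∈ C)
    (hx : x ∈ C) (hy : y ∈ C) (hz : z ∈ C) (hyx : G.Adj y x) (hyz : G.Adj y z) (hxz : x ≠ z)
    {v : V} (hv : G.Reachable y v) : v ∈ C := by
  rw [isConvex_iff] at hC
  let D : Set V := {w | ∃ hw : w ∈ C, (G.induce C).Reachable ⟨y, hy⟩ ⟨w, hw⟩}
  have hstep : ∀ w ∈ D, ∀ w' ∈ C, G.Adj w w' → w' ∈ D := by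
    rintro w ⟨hw, hr⟩ w' hw' hadj
    exact ⟨hw', hr.trans (SimpleGraph.Adj.reachable (G := G.induce C) (u := ⟨w, hw⟩)
      (v := ⟨w', hw'⟩) hadj)⟩
  have hyD : y ∈ D := ⟨hy, .refl _⟩
  have hDr : ∀ w ∈ D, G.Reachable y w := by
    rintro w ⟨hw, hr⟩
    exact hr.map (SimpleGraph.Embedding.induce C).toHom
  have hclosed : ∀ a b, G.Adj a b → a ∈ D → b ∈ D := by
    refine fun a b hab ha => hG.closed_of_connected (D := D) ?_ ?_ ?_ ?_ ?_ ha hab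
    · intro Q a ha haQ hQ
      have key : ∀ (u w : C), (G.induce C).Reachable u w → (u : V) ∈ D → (u : V) ∈ Q →
          (w : V) ∈ D ∧ (w : V) ∈ Q := by
        intro u w hr hu huQ
        refine of_reachable (P := fun w : C => (w : V) ∈ D ∧ (w : V) ∈ Q) ?_ hr ⟨hu, huQ⟩
        rintro p q hpq ⟨h1, h2⟩
        have hq := hstep p h1 q q.2 hpq
        exact ⟨hq, hQ p h1 q hq hpq h2⟩
      rintro w ⟨hw, hr⟩
      obtain ⟨haC, har⟩ := ha
      exact (key ⟨a, haC⟩ ⟨w, hw⟩ (har.symm.trans hr) ⟨haC, har⟩ haQ).2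
    · rintro v hv a ha b hb hva hvb
      by_contra hab
      have hvC : v ∉ C := fun hvC => hv (hstep a ha v hvC hva.symm)
      obtain ⟨ha, har⟩ := ha
      obtain ⟨hb, hbr⟩ := hb
      exact hC v hvC a b ha hb hab hva hvb (har.symm.trans hbr)
    · intro a b
      have hxD := hstep y hyD x hx hyx
      have hzD := hstep y hyD z hz hyz
      have h1 := hyx.ne
      have h2 := hyz.ne
      by_cases hxab : x ≠ a ∧ x ≠ b
      · exact ⟨x, hxD, hxab⟩
      by_cases hyab : y ≠ a ∧ y ≠ b
      · exact ⟨y, hyD, hyab⟩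
      exact ⟨z, hzD, by grind, by grind⟩
    · intro v hv a ha hva hvl
      exact hv (hstep a ha v (hleaf v ((hDr a ha).trans hva.symm.reachable) hvl) hva.symm)
    · exact fun a ha => hdom a (hDr a ha)
  obtain ⟨h, -⟩ : v ∈ D := of_reachable (P := (· ∈ D)) hclosed hv hyD
  exact h

/-- In a triangle-free `P₄`-sparse graph without leaves in the component of the edge `x y`, each
vertex of this component is adjacent to `x` or to `y`. -/
theorem IsP4Sparse.adj_or_adj (hG : IsP4Sparse G) {x y r : V} (hxy : G.Adj x y)
    (htri : ∀ a b c, G.Reachable x a → G.Adj a b → G.Adj b c → ¬ G.Adj a c)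
    (hleaf : ∀ v, G.Reachable x v → ¬ IsLeaf G v) (hr : G.Reachable x r) :
    G.Adj x r ∨ G.Adj y r := by
  have sy : ∀ {x y}, ¬ G.Adj x y → ¬ G.Adj y x := fun h h' => h h'.symm
  have key : ∀ x' y', G.Reachable x x' → G.Adj x' y' → ∀ u w, G.Adj x' u → G.Adj u w →
      ¬ G.Adj x' w → ¬ G.Adj y' w → False := by
    intro x y hx hxy u w hxu huw hxw hyw
    have huy : ¬ G.Adj u y := htri u x y (hx.trans hxu.reachable) hxu.symm hxy
    have hP : IsP4 G w u x y := ⟨huw.symm, hxu.symm, hxy, sy hxw, sy hyw, huy⟩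
    have hry := hx.trans hxy.reachable
    obtain ⟨z, hyz, hzx⟩ := exists_adj_ne (hleaf y hry) hxy.symm
    have hxz : ¬ G.Adj x z := htri x y z hx hxy hyz
    have hzu : z ≠ u := by rintro rfl; exact huy hyz.symm
    have hzw : z ≠ w := by rintro rfl; exact hyw hyz
    by_cases huz : G.Adj u z
    · have hwz : ¬ G.Adj w z := htri w u z ((hx.trans hxu.reachable).trans huw.reachable)
        huw.symm huz
      exact hG.elim (e := z) hP (a' := w) (b' := u) (c' := z) (d' := y)
        ⟨huw.symm, huz, hyz.symm, hwz, sy hyw, huy⟩ hzw hzu hzx hyz.ne' (by tauto) (by tauto)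
    · exact hG.elim (e := z) hP (a' := u) (b' := x) (c' := y) (d' := z)
        ⟨hxu.symm, hxy, hyz, huy, huz, hxz⟩ hzw hzu hzx hyz.ne' (by tauto) (by tauto)
  have := of_reachable (P := fun w => G.Adj x w ∨ G.Adj y w) (v := y) ?_
    (hxy.symm.reachable.trans hr) (Or.inl hxy)
  · exact this
  · intro u w huw hu
    by_contra! hcon
    rcases hu with hu | hu
    · exact key x y (.refl _) hxy u w hu huw hcon.1 hcon.2
    · exact key y x hxy.reachable hxy.symm u w hu huw hcon.2 hcon.1

/-! ### The hull number as a sum over components -/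

/-- `ρ` selects one vertex in each component and maps each vertex to the selected one of its
component. -/
structure IsRep (G : SimpleGraph V) (ρ : V → V) : Prop where
  reachable : ∀ v, G.Reachable v (ρ v)
  eq : ∀ v w, G.Reachable v w → ρ v = ρ w

theorem IsRep.eq_iff {ρ : V → V} (h : IsRep G ρ) {v w : V} : ρ v = ρ w ↔ G.Reachable v w :=
  ⟨fun e => (h.reachable v).trans (e ▸ (h.reachable w).symm), h.eq v w⟩

theorem IsRep.idem {ρ : V → V} (h : IsRep G ρ) (v : V) : ρ (ρ v) = ρ v :=
  (h.eq _ _ (h.reachable v)).symm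

theorem IsRep.reachable_of_eq {ρ : V → V} (h : IsRep G ρ) {v r : V} (e : ρ v = r) :
    G.Reachable r v := e ▸ (h.reachable v).symm

theorem isHullSet_univ [Fintype V] : IsHullSet G ((Finset.univ : Finset V) : Set V) :=
  isHullSet_iff.2 fun _ _ hC => Set.eq_univ_of_univ_subset (by simpa using hC)

open Classical in
/-- The hull number is the sum of the numbers of vertices needed in the components. -/
theorem hullNumber_eq_sum [Fintype V] {ρ : V → V} (hρ : IsRep G ρ) (h : V → ℕ)
    (hup : ∀ r, ρ r = r → ∃ T : Finset V, T.card ≤ h r ∧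
      ∀ C, IsConvex G C → (T : Set V) ⊆ C → ∀ v, ρ v = r → v ∈ C)
    (hlow : ∀ r, ρ r = r → ∀ S : Finset V, IsHullSet G (S : Set V) →
      h r ≤ (S.filter fun v => ρ v = r).card) :
    hullNumber G = ∑ r with ρ r = r, h r := by
  have hmaps : ∀ v : V, ρ v ∈ Finset.univ.filter fun r => ρ r = r := fun v => by
    simpa using hρ.idem v
  choose! T hT hTC using hup
  refine le_antisymm ?_ (le_csInf ⟨_, Finset.univ, isHullSet_univ, rfl⟩ ?_)
  · have hull : IsHullSet G
        (((Finset.univ.filter fun r => ρ r = r).biUnion T : Finset V) : Set V) := by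
      refine isHullSet_iff.2 fun C hC hS => Set.eq_univ_of_forall fun v => ?_
      refine hTC (ρ v) (hρ.idem v) C hC (fun w hw => hS ?_) v rfl
      exact Finset.mem_coe.2 (Finset.mem_biUnion.2 ⟨ρ v, hmaps v, hw⟩)
    calc hullNumber G ≤ _ := Nat.sInf_le ⟨_, hull, rfl⟩
      _ ≤ ∑ r with ρ r = r, (T r).card := Finset.card_biUnion_le
      _ ≤ _ := Finset.sum_le_sum fun r hr => hT r (by simpa using hr)
  · rintro k ⟨S, hS, rfl⟩
    rw [Finset.card_eq_sum_card_fiberwise (f := ρ) (t := Finset.univ.filter fun r => ρ r = r)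
      fun v _ => hmaps v]
    exact Finset.sum_le_sum fun r hr => hlow r (by simpa using hr) S hS

/-! ### Components with a dominating vertex -/

/-- `G` without the edges at vertices in `U`. -/
def cut (G : SimpleGraph V) (U : Set V) : SimpleGraph V where
  Adj v w := G.Adj v w ∧ v ∉ U ∧ w ∉ U
  symm := ⟨fun _ _ h => ⟨h.1.symm, h.2.2, h.2.1⟩⟩
  loopless := ⟨fun _ h => h.1.ne rfl⟩

theorem cut_le (U : Set V) : cut G U ≤ G := fun _ _ h => h.1

theorem eq_of_reachable_cut {U : Set V} {u v : V} (hu : u ∈ U) (h : (cut G U).Reachable u v) :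
    v = u :=
  of_reachable (G := cut G U) (P := fun v => v = u)
    (fun _ _ hxy hx => absurd hu (hx ▸ hxy.2.1)) h rfl

/-- If `u` dominates its component, the representatives of the components that are left when the
edges at `u` are deleted generate the whole component of `u`. -/
theorem Dominates.subset_of_isConvex {U : Set V} {u : V} (hu : u ∈ U) (hdom : Dominates G u)
    {ρ' : V → V} (hρ' : IsRep (cut G U) ρ') {C : Set V} (hC : IsConvex G C)
    (hrep : ∀ v, G.Reachable u v → ρ' v = v → v ∈ C) {v : V} (hv : G.Reachable u v) : v ∈ C := by
  rw [isConvex_iff] at hC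
  have huC : u ∈ C := hrep u (.refl _) (eq_of_reachable_cut hu (hρ'.reachable u))
  have hv' : G.Reachable u (ρ' v) := hv.trans ((hρ'.reachable v).mono (cut_le U))
  refine (of_reachable (P := fun x => x ∈ C ∧ G.Reachable u x) ?_ (hρ'.reachable v).symm
    ⟨hrep _ hv' (hρ'.idem v), hv'⟩).1
  rintro x y hxy ⟨hx, hux⟩
  have huy := hux.trans hxy.1.reachable
  refine ⟨?_, huy⟩
  have hxu : x ≠ u := by rintro rfl; exact hxy.2.1 hu
  have hyu : y ≠ u := by rintro rfl; exact hxy.2.2 hu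
  have h1 := (hdom x hux).resolve_left hxu
  have h2 := (hdom y huy).resolve_left hyu
  by_contra hy
  exact hC y hy u x huC hx hxu.symm h2.symm hxy.1.symm
    (SimpleGraph.Adj.reachable (G := G.induce C) (u := ⟨u, huC⟩) (v := ⟨x, hx⟩) h1)

open Classical in
/-- Every hull set meets each component `Z` that is left after deleting the edges at `u`, except
possibly `{u}`, because `u` is the only neighbour of `Z` outside. If it misses `u` and meets each
`Z` only once, then it spans no edge and generates nothing in the component of `u`. -/
theorem card_le_of_isHullSet_of_mem [Fintype V] {U : Set V} {u : V} (hu : u ∈ U)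
    (hU : ∀ v ∈ U, G.Reachable u v → v = u) {ρ ρ' : V → V} (hρ : IsRep G ρ)
    (hρ' : IsRep (cut G U) ρ') {S : Finset V} (hS : IsHullSet G (S : Set V)) :
    (Finset.univ.filter fun v => ρ v = ρ u ∧ ρ' v = v).card ≤
      (S.filter fun v => ρ v = ρ u).card := by
  set T := Finset.univ.filter fun v => ρ v = ρ u ∧ ρ' v = v
  set S' := S.filter fun v => ρ v = ρ u
  have hcut : ∀ x y, G.Reachable u x → G.Adj x y → x ≠ u → y ≠ u → (cut G U).Adj x y :=
    fun x y hux hxy hx hy => ⟨hxy, fun h => hx (hU x h hux),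
      fun h => hy (hU y h (hux.trans hxy.reachable))⟩
  have hmeet : ∀ v ∈ T, v ≠ u → v ∈ S'.image ρ' := by
    intro v hv hvu
    simp only [T, Finset.mem_filter, Finset.mem_univ, true_and] at hv
    have huv : G.Reachable u v := hρ.eq_iff.1 hv.1.symm
    have hZ : ∀ x, ρ' x = v → G.Reachable u x := fun x hx =>
      huv.trans (((hρ'.reachable_of_eq hx)).mono (cut_le U))
    obtain ⟨s, hs, hsZ⟩ := hS.exists_mem (Z := {x | ρ' x = v}) (v := v) hv.2 (by
      have key : ∀ x, ρ' x = v → ∀ a, ρ' a ≠ v → G.Adj x a → a = u := by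
        intro x hx a ha hxa
        by_contra hau
        have hxu : x ≠ u := by
          rintro rfl
          exact hvu (eq_of_reachable_cut hu (hx ▸ hρ'.reachable x))
        have := hρ'.eq _ _ (hcut x a (hZ x hx) hxa hxu hau).reachable
        exact ha (this ▸ hx)
      intro x hx a ha b hb hxa hxb
      rw [key x hx a ha hxa, key x hx b hb hxb])
    refine Finset.mem_image.2 ⟨s, Finset.mem_filter.2 ⟨hs, ?_⟩, hsZ⟩
    exact hρ.eq _ _ (hZ s hsZ).symm
  have huT : u ∈ T := by
    simp only [T, Finset.mem_filter, Finset.mem_univ, true_and]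
    exact eq_of_reachable_cut hu (hρ'.reachable u)
  by_cases huS : u ∈ S
  · refine (Finset.card_le_card fun v hv => ?_).trans
      (Finset.card_image_le (s := S') (f := ρ'))
    by_cases hvu : v = u
    · subst hvu
      exact Finset.mem_image.2 ⟨v, Finset.mem_filter.2 ⟨huS, rfl⟩,
        eq_of_reachable_cut hu (hρ'.reachable v)⟩
    · exact hmeet v hv hvu
  · by_contra! hlt
    have h1 : (T.erase u).card ≤ (S'.image ρ').card := Finset.card_le_card fun v hv =>
      hmeet v (Finset.mem_of_mem_erase hv) (Finset.ne_of_mem_erase hv)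
    rw [Finset.card_erase_of_mem huT] at h1
    have h2 : (S'.image ρ').card ≤ S'.card := Finset.card_image_le
    have hinj : Set.InjOn ρ' S' := Finset.card_image_iff.1 (by omega)
    refine huS (hS.subset_of (X := {v | ρ v = ρ u}) ?_ ?_ (show ρ u = ρ u from rfl))
    · intro v w hvw hv
      exact (hρ.eq _ _ hvw.reachable).symm.trans hv
    · rintro v - - a ha haS b - - - - - ⟨z, hz, hzS, haz⟩ -
      have hau : a ≠ u := by rintro rfl; exact huS haS
      have hzu : z ≠ u := by rintro rfl; exact huS hzS
      have := hρ'.eq _ _ (hcut a z (hρ.eq_iff.1 (Eq.symm ha)) haz hau hzu).reachable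
      exact haz.ne (hinj (Finset.mem_coe.2 (Finset.mem_filter.2 ⟨haS, ha⟩))
        (Finset.mem_coe.2 (Finset.mem_filter.2 ⟨hzS, hz⟩)) this)

/-! ### Components without a dominating vertex -/

/-- The component of `v` contains neither a leaf nor a triangle. -/
def Plain (G : SimpleGraph V) (v : V) : Prop :=
  (∀ w, G.Reachable v w → ¬ IsLeaf G w) ∧
    ∀ a b c, G.Reachable v a → G.Adj a b → G.Adj b c → ¬ G.Adj a c

open Classical in
/-- Besides all leaves, a hull set contains two more vertices of a component without a dominating
vertex: with at most one more, no vertex outside has two neighbours that are connected. -/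
theorem card_leaves_add_two_le [Fintype V] {ρ : V → V} (hρ : IsRep G ρ) {r : V} (hr : ρ r = r)
    (hdom : ∀ v, G.Reachable r v → ¬ Dominates G v) {S : Finset V}
    (hS : IsHullSet G (S : Set V)) :
    (Finset.univ.filter fun v => ρ v = r ∧ IsLeaf G v).card + 2 ≤
      (S.filter fun v => ρ v = r).card := by
  set L := Finset.univ.filter fun v => ρ v = r ∧ IsLeaf G v
  set S' := S.filter fun v => ρ v = r
  have hL : L ⊆ S' := by
    intro v hv
    simp only [L, Finset.mem_filter, Finset.mem_univ, true_and] at hv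
    obtain ⟨s, hs, rfl⟩ := hS.exists_mem (Z := {v}) (v := v) rfl (by
      obtain ⟨w, -, hw⟩ := hv.2
      rintro x rfl a - b - hxa hxb
      rw [hw a hxa, hw b hxb])
    exact Finset.mem_filter.2 ⟨hs, hv.1⟩
  by_contra! hlt
  have h1 : (S' \ L).card ≤ 1 := by
    rw [Finset.card_sdiff_of_subset hL]
    omega
  rw [Finset.card_le_one] at h1
  have hmem : ∀ a, ρ a = r → a ∈ S → ¬ IsLeaf G a → a ∈ S' \ L := fun a h2 h3 h4 => by
    simp [S', L, h2, h3, h4]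
  have hsub : {v | ρ v = r} ⊆ (S : Set V) := by
    refine hS.subset_of ?_ ?_
    · intro v w hvw hv
      exact (hρ.eq _ _ hvw.reachable).symm.trans hv
    · rintro v - hvS a ha haS b hb hbS hab hva hvb ⟨z, -, hzS, haz⟩ ⟨z', -, hzS', hbz⟩
      have key : ∀ a z, G.Adj v a → z ∈ S → G.Adj a z → ¬ IsLeaf G a := by
        rintro a z hva hz haz ⟨w, -, hw⟩
        have : v = z := (hw v hva.symm).trans (hw z haz).symm
        exact hvS (this ▸ hz)
      exact hab (h1 a (hmem a ha haS (key a z hva hzS haz)) b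
        (hmem b hb hbS (key b z' hvb hzS' hbz)))
  have hne : ∀ v, G.Reachable r v → ∃ y, G.Adj v y ∧ ¬ IsLeaf G y := by
    intro v hv
    obtain ⟨y, z, hvy, hyz, hzv, -⟩ := exists_distance_two (hdom v hv)
    exact ⟨y, hvy, fun ⟨w, _, hw⟩ => hzv ((hw z hyz).trans (hw v hvy.symm).symm)⟩
  obtain ⟨y, hry, hy⟩ := hne r (.refl _)
  obtain ⟨x, hyx, hx⟩ := hne y hry.reachable
  have h2 : ρ y = r := (hρ.eq _ _ hry.symm.reachable).trans hr
  have h3 : ρ x = r := (hρ.eq _ _ hyx.symm.reachable).trans h2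
  exact hyx.ne (h1 y (hmem y h2 (hsub h2) hy) x (hmem x h3 (hsub h3) hx))

open Classical in
/-- Two vertices generate nothing where there are no triangles. -/
theorem three_le_of_plain [Fintype V] {ρ : V → V} (hρ : IsRep G ρ) {r : V} (hr : ρ r = r)
    (hdom : ¬ Dominates G r) (hplain : Plain G r) {S : Finset V} (hS : IsHullSet G (S : Set V)) :
    3 ≤ (S.filter fun v => ρ v = r).card := by
  set S' := S.filter fun v => ρ v = r
  by_contra! hlt
  have hthree : ∀ a ∈ S', ∀ b ∈ S', ∀ c ∈ S', a ≠ b → a ≠ c → b ≠ c → False := by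
    intro a ha b hb c hc hab hac hbc
    have h1 : ({a, b, c} : Finset V) ⊆ S' := by
      simp only [Finset.insert_subset_iff, Finset.singleton_subset_iff]
      exact ⟨ha, hb, hc⟩
    have := Finset.card_le_card h1
    rw [Finset.card_eq_three.2 ⟨a, b, c, hab, hac, hbc, rfl⟩] at this
    omega
  have hmem : ∀ a, ρ a = r → a ∈ S → a ∈ S' := fun a h2 h3 => by simp [S', h2, h3]
  have hsub : {v | ρ v = r} ⊆ (S : Set V) := by
    refine hS.subset_of ?_ ?_
    · intro v w hvw hv
      exact (hρ.eq _ _ hvw.reachable).symm.trans hv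
    · rintro v hv hvS a ha haS b hb hbS hab hva hvb ⟨z, hz, hzS, haz⟩ -
      by_cases hzb : z = b
      · subst hzb
        exact hplain.2 v a z (hρ.reachable_of_eq hv) hva haz hvb
      · exact hthree a (hmem a ha haS) b (hmem b hb hbS) z (hmem z hz hzS) hab haz.ne
          (Ne.symm hzb)
  obtain ⟨y, z, hry, hyz, hzr, -⟩ := exists_distance_two hdom
  have h2 : ρ y = r := (hρ.eq _ _ hry.symm.reachable).trans hr
  have h3 : ρ z = r := (hρ.eq _ _ hyz.symm.reachable).trans h2
  exact hthree r (hmem r hr (hsub hr)) y (hmem y h2 (hsub h2)) z (hmem z h3 (hsub h3)) hry.ne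
    hzr.symm hyz.ne

open Classical in
/-- In a component without a dominating vertex of a `P₄`-sparse graph, all leaves and the ends of
a suitable edge generate everything; if there is neither a leaf nor a triangle, the vertices of a
path on three vertices do. -/
theorem IsP4Sparse.exists_generating [Fintype V] (hG : IsP4Sparse G) {ρ : V → V}
    (hρ : IsRep G ρ) {r : V} (hr : ρ r = r) (hdom : ∀ v, G.Reachable r v → ¬ Dominates G v) :
    ∃ T : Finset V, T.card ≤ (Finset.univ.filter fun v => ρ v = r ∧ IsLeaf G v).card + 2 +
        (if Plain G r then 1 else 0) ∧
      ∀ C, IsConvex G C → (T : Set V) ⊆ C → ∀ v, ρ v = r → v ∈ C := by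
  set L := Finset.univ.filter fun v => ρ v = r ∧ IsLeaf G v
  have hLmem : ∀ {v}, G.Reachable r v → IsLeaf G v → v ∈ L := fun {v} h1 h2 => by
    have : ρ v = r := (hρ.eq _ _ h1.symm).trans hr
    simp [L, this, h2]
  have hcard : ∀ x y : V, (L ∪ {x, y}).card ≤ L.card + 2 := fun x y =>
    (Finset.card_union_le _ _).trans (Nat.add_le_add_left Finset.card_le_two _)
  -- a path on three vertices inside a convex set that contains the leaves suffices
  have key : ∀ C, IsConvex G C → (L : Set V) ⊆ C → ∀ x y z, G.Reachable r y → x ∈ C → y ∈ C →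
      z ∈ C → G.Adj y x → G.Adj y z → x ≠ z → ∀ v, ρ v = r → v ∈ C := by
    intro C hC hL x y z hy hxC hyC hzC hyx hyz hxz v hv
    exact hG.subset_of_isConvex hC (fun v hv => hdom v (hy.trans hv))
      (fun v hv hl => hL (hLmem (hy.trans hv) hl)) hxC hyC hzC hyx hyz hxz
      (hy.symm.trans (hρ.reachable_of_eq hv))
  by_cases hplain : Plain G r
  · obtain ⟨y, z, hry, hyz, hzr, -⟩ := exists_distance_two (hdom r (.refl _))
    refine ⟨{r, y, z}, ?_, fun C hC hT => ?_⟩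
    · rw [if_pos hplain]
      exact Finset.card_le_three.trans (by omega)
    · simp only [Finset.coe_insert, Finset.coe_singleton, Set.insert_subset_iff,
        Set.singleton_subset_iff] at hT
      refine key C hC ?_ r y z hry.reachable hT.1 hT.2.1 hT.2.2 hry.symm hyz hzr.symm
      intro v hv
      simp only [L, Finset.coe_filter, Finset.mem_univ, true_and, Set.mem_ofPred_eq] at hv
      exact absurd hv.2 (hplain.1 v (hρ.reachable_of_eq hv.1))
  · rw [if_neg hplain]
    by_cases hleaf : ∃ s, G.Reachable r s ∧ IsLeaf G s
    · obtain ⟨s, hrs, hs⟩ := hleaf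
      obtain ⟨y, hsy, hy⟩ := hs
      have hry := hrs.trans hsy.reachable
      obtain ⟨x, z, hyx, hxz, hzy, -⟩ := exists_distance_two (hdom y hry)
      refine ⟨L ∪ {y, x}, hcard y x, fun C hC hT => ?_⟩
      simp only [Finset.coe_union, Finset.coe_insert, Finset.coe_singleton, Set.union_subset_iff,
        Set.insert_subset_iff, Set.singleton_subset_iff] at hT
      refine key C hC hT.1 s y x hry (hT.1 (hLmem hrs ⟨y, hsy, hy⟩)) hT.2.1 hT.2.2 hsy.symm hyx ?_
      rintro rfl
      exact hzy (hy z hxz)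
    · have : ∃ a b c, G.Reachable r a ∧ G.Adj a b ∧ G.Adj b c ∧ G.Adj a c := by
        by_contra! hcon
        push Not at hleaf
        exact hplain ⟨hleaf, hcon⟩
      obtain ⟨a, b, c, hra, hab, hbc, hac⟩ := this
      refine ⟨L ∪ {a, b}, hcard a b, fun C hC hT => ?_⟩
      simp only [Finset.coe_union, Finset.coe_insert, Finset.coe_singleton, Set.union_subset_iff,
        Set.insert_subset_iff, Set.singleton_subset_iff] at hT
      have hc : c ∈ C := by
        by_contra hc
        exact isConvex_iff.1 hC c hc a b hT.2.1 hT.2.2 hab.ne hac.symm hbc.symm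
          (SimpleGraph.Adj.reachable (G := G.induce C) (u := ⟨a, hT.2.1⟩) (v := ⟨b, hT.2.2⟩) hab)
      exact key C hC hT.1 b a c hra hT.2.2 hT.2.1 hc hab hac hbc.ne

/-! ### The hull number as a sum over vertices -/

open Classical in
/-- The hull number of a `P₄`-sparse graph as a sum of local terms. The set `U` consists of one
dominating vertex of each component that has one, `ρ` selects representatives of the components,
and `ρ'` representatives of the components that are left when the edges at `U` are deleted. -/
theorem IsP4Sparse.hullNumber_eq [Fintype V] (hG : IsP4Sparse G) {U : Set V}
    (hdom : ∀ u ∈ U, Dominates G u) (huniq : ∀ u ∈ U, ∀ u' ∈ U, G.Reachable u u' → u' = u)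
    (hex : ∀ v, Dominates G v → ∃ u ∈ U, G.Reachable v u) {ρ ρ' : V → V} (hρ : IsRep G ρ)
    (hρ' : IsRep (cut G U) ρ') :
    hullNumber G = ∑ v, ((if ρ' v = v then 1 else 0) +
      if ∃ u ∈ U, G.Reachable v u then 0 else (if IsLeaf G v then 1 else 0) +
        if ρ v = v then 1 + (if Plain G v then 1 else 0) else 0) := by
  set f : V → ℕ := fun v => (if ρ' v = v then 1 else 0) +
      if ∃ u ∈ U, G.Reachable v u then 0 else (if IsLeaf G v then 1 else 0) +
        if ρ v = v then 1 + (if Plain G v then 1 else 0) else 0 with hf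
  have htop : ∀ r, ρ r = r → (∃ u ∈ U, G.Reachable r u) → ∑ v with ρ v = r, f v =
      (Finset.univ.filter fun v => ρ v = r ∧ ρ' v = v).card := by
    rintro r hr ⟨u, hu, hru⟩
    rw [← Finset.filter_filter, Finset.card_filter]
    refine Finset.sum_congr rfl fun v hv => ?_
    have hv : ρ v = r := by simpa using hv
    have : ∃ u ∈ U, G.Reachable v u := ⟨u, hu, (hρ.reachable_of_eq hv).symm.trans hru⟩
    simp only [hf, if_pos this, add_zero]
  have hnon : ∀ r, ρ r = r → (¬ ∃ u ∈ U, G.Reachable r u) → ∑ v with ρ v = r, f v =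
      (Finset.univ.filter fun v => ρ v = r ∧ IsLeaf G v).card + 2 +
        if Plain G r then 1 else 0 := by
    intro r hr hno
    have hsame : ∀ v, G.Reachable r v → (cut G U).Reachable r v := by
      intro v hv
      refine (of_reachable (P := fun v => G.Reachable r v ∧ (cut G U).Reachable r v) ?_ hv
        ⟨.refl _, .refl _⟩).2
      rintro x y hxy ⟨h1, h2⟩
      refine ⟨h1.trans hxy.reachable, h2.trans (SimpleGraph.Adj.reachable ⟨hxy, ?_, ?_⟩)⟩
      · exact fun hx => hno ⟨x, hx, h1⟩
      · exact fun hy => hno ⟨y, hy, h1.trans hxy.reachable⟩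
    have h1 : ∑ v with ρ v = r, (if ρ' v = v then 1 else 0) = 1 := by
      rw [← Finset.card_filter, Finset.card_eq_one]
      refine ⟨ρ' r, ?_⟩
      ext v
      simp only [Finset.mem_filter, Finset.mem_univ, true_and, Finset.mem_singleton]
      constructor
      · rintro ⟨hv, hv'⟩
        rw [← hv']
        exact (hρ'.eq _ _ (hsame v (hρ.reachable_of_eq hv))).symm
      · rintro rfl
        exact ⟨(hρ.eq _ _ ((hρ'.reachable r).mono (cut_le U))).symm.trans hr, hρ'.idem r⟩
    have h2 : ∑ v with ρ v = r, (if ρ v = v then 1 + (if Plain G v then 1 else 0) else 0) =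
        1 + if Plain G r then 1 else 0 := by
      rw [Finset.sum_eq_single r]
      · rw [if_pos hr]
      · intro v hv hvr
        have hv : ρ v = r := by simpa using hv
        rw [if_neg (fun h => hvr (h.symm.trans hv))]
      · intro h
        simp [hr] at h
    have h3 : ∑ v with ρ v = r, f v = ∑ v with ρ v = r, ((if ρ' v = v then 1 else 0) +
        ((if IsLeaf G v then 1 else 0) +
        if ρ v = v then 1 + (if Plain G v then 1 else 0) else 0)) := by
      refine Finset.sum_congr rfl fun v hv => ?_
      have hv : ρ v = r := by simpa using hv
      have : ¬ ∃ u ∈ U, G.Reachable v u := fun ⟨u, hu, h⟩ =>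
        hno ⟨u, hu, (hρ.reachable_of_eq hv).trans h⟩
      simp only [hf, if_neg this]
    rw [h3, Finset.sum_add_distrib, Finset.sum_add_distrib, h1, h2, ← Finset.filter_filter,
      Finset.card_filter (fun v => IsLeaf G v)]
    omega
  have hnodom : ∀ r, (¬ ∃ u ∈ U, G.Reachable r u) → ∀ v, G.Reachable r v → ¬ Dominates G v :=
    fun r hno v hv hd => by
      obtain ⟨u, hu, hvu⟩ := hex v hd
      exact hno ⟨u, hu, hv.trans hvu⟩
  rw [hullNumber_eq_sum hρ fun r => ∑ v with ρ v = r, f v]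
  · exact Finset.sum_fiberwise_of_maps_to (fun v _ => by simpa using hρ.idem v) _
  · intro r hr
    by_cases h : ∃ u ∈ U, G.Reachable r u
    · rw [htop r hr h]
      obtain ⟨u, hu, hru⟩ := h
      refine ⟨_, le_rfl, fun C hC hT v hv => ?_⟩
      refine (hdom u hu).subset_of_isConvex hu hρ' hC (fun w hw hw' => hT ?_)
        (hru.symm.trans (hρ.reachable_of_eq hv))
      simp only [Finset.coe_filter, Finset.mem_univ, true_and, Set.mem_ofPred_eq]
      exact ⟨(hρ.eq _ _ (hru.trans hw)).symm.trans hr, hw'⟩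
    · rw [hnon r hr h]
      exact hG.exists_generating hρ hr (hnodom r h)
  · intro r hr S hS
    by_cases h : ∃ u ∈ U, G.Reachable r u
    · rw [htop r hr h]
      obtain ⟨u, hu, hru⟩ := h
      have hur : ρ u = r := (hρ.eq _ _ hru).symm.trans hr
      have := card_le_of_isHullSet_of_mem hu (fun v hv h => huniq u hu v hv h) hρ hρ' hS
      rwa [hur] at this
    · rw [hnon r hr h]
      have h1 := card_leaves_add_two_le hρ hr (hnodom r h) hS
      split_ifs with hplain
      · have h2 := three_le_of_plain hρ hr (hnodom r h r (.refl _)) hplain hS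
        have h3 : (Finset.univ.filter fun v => ρ v = r ∧ IsLeaf G v).card = 0 := by
          rw [Finset.card_eq_zero, Finset.filter_eq_empty_iff]
          exact fun v _ hv => hplain.1 v (hρ.reachable_of_eq hv.1) hv.2
        omega
      · exact h1

/-! ### Diameter, degrees and colours -/

theorem IsP4Sparse.cut (hG : IsP4Sparse G) (U : Set V) : IsP4Sparse (cut G U) := by
  have key : ∀ B, InducesP4 (CycleConvexity.cut G U) B → InducesP4 G B := by
    rintro B ⟨e⟩
    -- no vertex of an induced path is isolated, so the path avoids `U`
    have hU : ∀ x : (B : Set V), (x : V) ∉ U := by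
      intro x
      have : ∀ i : Fin 4, ∃ j, (SimpleGraph.pathGraph 4).Adj i j := by
        simp only [SimpleGraph.pathGraph_adj]
        decide
      obtain ⟨j, hj⟩ := this (e x)
      have h : ((CycleConvexity.cut G U).induce (B : Set V)).Adj x (e.symm j) := by
        rw [← e.map_adj_iff]
        simpa using hj
      exact h.2.1
    refine ⟨⟨e.toEquiv, fun {x y} => e.map_adj_iff.trans ⟨fun h => h.1, fun h => ?_⟩⟩⟩
    exact ⟨h, hU x, hU y⟩
  exact fun A hA B₁ B₂ h₁ h₂ hB₁ hB₂ => hG A hA B₁ B₂ h₁ h₂ (key _ hB₁) (key _ hB₂)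

/-- The components of a `P₄`-sparse graph have diameter at most three, since an induced path on
five vertices contains two induced paths on four vertices. -/
theorem IsP4Sparse.exists_three_steps (hG : IsP4Sparse G) {v w : V} (h : G.Reachable v w) :
    ∃ a b, (v = a ∨ G.Adj v a) ∧ (a = b ∨ G.Adj a b) ∧ (b = w ∨ G.Adj b w) := by
  refine of_reachable (P := fun w => ∃ a b, (v = a ∨ G.Adj v a) ∧ (a = b ∨ G.Adj a b) ∧
    (b = w ∨ G.Adj b w)) ?_ h ⟨v, v, Or.inl rfl, Or.inl rfl, Or.inl rfl⟩
  rintro w x hwx ⟨a, b, hva, hab, hbw⟩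
  by_contra! hcon
  rcases hva with rfl | hva
  · exact (hcon b w hab hbw).2 hwx
  rcases hab with rfl | hab
  · exact (hcon a w (Or.inr hva) hbw).2 hwx
  rcases hbw with rfl | hbw
  · exact (hcon a b (Or.inr hva) (Or.inr hab)).2 hwx
  have h1 := hcon a b (Or.inr hva) (Or.inr hab)
  have h2 := fun h => (hcon a w (Or.inr hva) (Or.inr h)).2 hwx
  have h3 := fun h => (hcon b w (Or.inr h) (Or.inr hbw)).2 hwx
  have h4 := fun h => (hcon w w (Or.inr h) (Or.inl rfl)).2 hwx
  have h5 := hcon a a (Or.inr hva) (Or.inl rfl)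
  have h6 := hcon v v (Or.inl rfl) (Or.inl rfl)
  exact hG.elim (e := x) (a := v) (b := a) (c := b) (d := w) ⟨hva, hab, hbw, h3, h4, h2⟩
    (a' := a) (b' := b) (c' := w) (d' := x) ⟨hab, hbw, hwx, h2, h5.2, h1.2⟩
    h6.1.symm h5.1.symm h1.1.symm hwx.ne' (by tauto) (by tauto)

/-- A component without leaves is triangle-free if and only if it is properly coloured by the
adjacency to any one of its vertices. -/
theorem IsP4Sparse.plain_iff (hG : IsP4Sparse G) {r : V} : Plain G r ↔
    ∀ w, G.Reachable r w → ¬ IsLeaf G w ∧ ∀ y, G.Adj w y → ¬ (G.Adj w r ↔ G.Adj y r) := by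
  constructor
  · rintro ⟨hleaf, htri⟩ w hw
    refine ⟨hleaf w hw, fun y hwy hiff => ?_⟩
    have h1 := hG.adj_or_adj hwy (fun a b c h => htri a b c (hw.trans h))
      (fun v h => hleaf v (hw.trans h)) hw.symm
    have h2 := htri w y r hw hwy
    tauto
  · intro h
    refine ⟨fun w hw => (h w hw).1, fun a b c hra hab hbc hac => ?_⟩
    have hrb := hra.trans hab.reachable
    have h1 := (h a hra).2 b hab
    have h2 := (h b hrb).2 c hbc
    have h3 := (h a hra).2 c hac
    tauto

/-- Three rounds in which each vertex takes over labels of its neighbours that are smaller than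
its own, starting from its own number, determine the smallest number in the component. -/
theorem IsP4Sparse.exists_isRep {n : ℕ} {H : SimpleGraph (Fin n)} (hH : IsP4Sparse H)
    {l₀ l₁ l₂ l₃ : ℕ → ℕ} (h₀ : ∀ v : Fin n, l₀ v = v)
    (h₁ : ∀ v w : Fin n, v = w ∨ H.Adj v w → l₁ v ≤ l₀ w)
    (h₂ : ∀ v w : Fin n, v = w ∨ H.Adj v w → l₂ v ≤ l₁ w)
    (h₃ : ∀ v w : Fin n, v = w ∨ H.Adj v w → l₃ v ≤ l₂ w)
    (hr : ∀ v : Fin n, ∃ w : Fin n, H.Reachable v w ∧ l₃ v = w) :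
    ∃ ρ : Fin n → Fin n, IsRep H ρ ∧ ∀ v : Fin n, l₃ v = ρ v := by
  choose ρ hρ hρl using hr
  refine ⟨ρ, ⟨hρ, fun v w hvw => ?_⟩, hρl⟩
  have key : ∀ v w, H.Reachable v w → ρ v ≤ w := by
    intro v w hvw
    obtain ⟨a, b, h1, h2, h3⟩ := hH.exists_three_steps hvw
    have := (h₃ v a h1).trans ((h₂ a b h2).trans (h₁ b w h3))
    rwa [h₀, hρl, Fin.val_fin_le] at this
  exact le_antisymm (key v _ (hvw.trans (hρ w))) (key w _ (hvw.symm.trans (hρ v)))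

/-- A vertex dominates its component if and only if its degree is large enough. -/
theorem dominates_iff [Fintype V] [DecidableEq V] {ρ : V → V} (hρ : IsRep G ρ) (v : V)
    {l : List V} (hl : l.Nodup) (hmem : ∀ w, w ∈ l ↔ G.Adj v w) :
    Dominates G v ↔ l.length + 1 = (Finset.univ.filter fun w => ρ w = ρ v).card := by
  have h1 : (insert v l.toFinset).card = l.length + 1 := by
    rw [Finset.card_insert_of_notMem (by simp [hmem]), List.toFinset_card_of_nodup hl]
  have h2 : insert v l.toFinset ⊆ Finset.univ.filter fun w => ρ w = ρ v := by
    intro w hw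
    simp only [Finset.mem_insert, List.mem_toFinset, hmem] at hw
    simp only [Finset.mem_filter, Finset.mem_univ, true_and]
    rcases hw with rfl | hw
    · rfl
    · exact (hρ.eq _ _ hw.reachable).symm
  constructor
  · intro h
    rw [← h1]
    refine congrArg _ (h2.antisymm fun w hw => ?_)
    simp only [Finset.mem_filter, Finset.mem_univ, true_and] at hw
    simpa [hmem] using h w (hρ.eq_iff.1 hw.symm)
  · intro h w hw
    have := Finset.eq_of_subset_of_card_le h2 (by omega)
    have hw' : w ∈ insert v l.toFinset := by
      rw [this]
      simp [hρ.eq _ _ hw]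
    simpa [hmem] using hw'

theorem isLeaf_iff {v : V} {l : List V} (hl : l.Nodup) (hmem : ∀ w, w ∈ l ↔ G.Adj v w) :
    IsLeaf G v ↔ l.length = 1 := by
  simp only [IsLeaf, ← hmem, List.length_eq_one_iff]
  constructor
  · rintro ⟨w, hw, h⟩
    refine ⟨w, List.perm_singleton.1 ((List.perm_ext_iff_of_nodup hl (by simp)).2 fun z => ?_)⟩
    simp only [List.mem_singleton]
    exact ⟨h z, fun e => e ▸ hw⟩
  · rintro ⟨w, rfl⟩
    simp

end Convexity

/-! ### The algorithm -/

/-- If `r = s` then `c`, else nothing (register `7` is never read). -/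
def Cmd.ifEq (r q : ℕ) (c : Cmd) : Cmd := .ite r q (.zero 7) (.ite q r (.zero 7) c)

/-- The current vertex takes over the label of the current neighbour if that one is smaller and
neither of them is masked. Labels are in array `k`, the mask is in array `3`. -/
def relax (k : Fin 8) : Cmd :=
  .seq (.load 2 3 0) <| .seq (.load 3 3 1) <| .seq (.zero 4) <| .ifEq 2 4 <| .ifEq 3 4 <|
    .seq (.load 5 k 0) <| .seq (.load 6 k 1) <| .ite 6 5 (.store k 0 6) (.zero 7)

/-- Count the current vertex in array `1`, at its label from array `0`. -/
def countLabel : Cmd :=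
  .seq (.load 2 0 0) <| .seq (.load 3 1 2) <| .seq (.inc 3) <| .store 1 2 3

/-- Put the degree of the current vertex into register `3`. -/
def degree : VCmd := .seq (.cmd (.zero 3)) (.nbr (.inc 3))

/-- Mask the current vertex, in array `3`, if it dominates its component and no other vertex has
been masked there, which is recorded in array `2` at the label of the component. -/
def maskDominating : VCmd :=
  .seq degree <| .cmd <| .seq (.inc 3) <| .seq (.load 2 0 0) <| .seq (.load 4 1 2) <|
    .seq (.load 5 2 2) <| .seq (.zero 6) <| .ifEq 3 4 <| .ifEq 5 6 <| .seq (.inc 6) <|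
    .seq (.store 2 2 6) (.store 3 0 6)

/-- Colour the current vertex, in array `5`, if the current neighbour is the vertex after which
its component is labelled. -/
def colour : Cmd :=
  .seq (.load 2 0 0) <| .ifEq 2 1 <| .seq (.zero 3) <| .seq (.inc 3) <| .store 5 0 3

/-- Record in array `6`, at the label of the component, that the current vertex and its current
neighbour have the same colour. -/
def checkColour : Cmd :=
  .seq (.load 2 5 0) <| .seq (.load 3 5 1) <| .ifEq 2 3 <| .seq (.load 4 0 0) <| .seq (.zero 5) <|
    .seq (.inc 5) <| .store 6 4 5

/-- Record in array `6`, at the label of the component, that the current vertex is a leaf or has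
a neighbour of its own colour. -/
def flagComponent : VCmd :=
  .seq (.nbr checkColour) <| .seq degree <| .cmd <| .seq (.zero 5) <| .seq (.inc 5) <|
    .ifEq 3 5 <| .seq (.load 4 0 0) <| .store 6 4 5

/-- Add the contribution of the current vertex to register `9`. -/
def addContribution : VCmd :=
  .seq degree <| .cmd <| .seq (.seq (.load 2 4 0) (.ifEq 2 0 (.inc 9))) <|
    .seq (.load 2 0 0) <| .seq (.load 4 2 2) <| .seq (.zero 5) <| .ifEq 4 5 <|
    .seq (.seq (.inc 5) (.ifEq 3 5 (.inc 9))) <| .ifEq 2 0 <| .seq (.inc 9) <|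
    .seq (.load 6 6 2) <| .seq (.zero 5) <| .ifEq 6 5 <| .inc 9

/-- Label the components of the graph of the unmasked vertices in array `k`. -/
def labelComponents (k : Fin 8) : List VCmd :=
  [.cmd (.store k 0 0), .nbr (relax k), .nbr (relax k), .nbr (relax k)]

/-- The algorithm; the result is in register `9`. Register `0` holds the current vertex and
register `1` the current neighbour. The arrays are: `0`, labels of the components; `1`, their
sizes; `2`, whether they have a masked vertex; `3`, the mask; `4`, labels of the components of the
unmasked part; `5`, colours; `6`, whether a component has a leaf or a badly coloured edge. The
arrays `1`, `2` and `6` are indexed by labels, the others by vertices. -/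
def algorithm : List VCmd :=
  labelComponents 0 ++ [.cmd countLabel, maskDominating] ++ labelComponents 4 ++
    [.nbr colour, flagComponent, .cmd (.zero 9), addContribution]

/-! ### Effect of the commands -/

section Semantics

variable {s : AState}

@[simp]
theorem AState.setReg_arr (r v : ℕ) (k : Fin 8) : (s.setReg r v).arr k = s.arr k := rfl

@[simp]
theorem AState.setReg_reg (r v q : ℕ) :
    (s.setReg r v).reg q = if q = r then v else s.reg q := by
  simp [AState.setReg, Function.update_apply]

@[simp]
theorem AState.setArr_reg (k : Fin 8) (a v : ℕ) : (s.setArr k a v).reg = s.reg := rfl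

@[simp]
theorem AState.setArr_arr (k : Fin 8) (a v : ℕ) (j : Fin 8) (b : ℕ) :
    (s.setArr k a v).arr j b = if j = k ∧ b = a then v else s.arr j b := by
  by_cases hj : j = k
  · subst hj
    simp [AState.setArr, Function.update_apply]
  · simp [AState.setArr, hj]

@[simp]
theorem Cmd.sem_ifEq (r q : ℕ) (c : Cmd) :
    (Cmd.ifEq r q c).sem s = if s.reg r = s.reg q then c.sem s else s.setReg 7 0 := by
  simp only [Cmd.ifEq, Cmd.sem]
  rcases lt_trichotomy (s.reg r) (s.reg q) with h | h | h
  · simp [h, h.ne]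
  · simp [h]
  · simp [h, h.ne', h.not_gt]

@[simp]
theorem AState.arr_ite (p : Prop) [Decidable p] (t : AState) (k : Fin 8) (a : ℕ) :
    (if p then s else t).arr k a = if p then s.arr k a else t.arr k a := by split_ifs <;> rfl

@[simp]
theorem AState.reg_ite (p : Prop) [Decidable p] (t : AState) (r : ℕ) :
    (if p then s else t).reg r = if p then s.reg r else t.reg r := by split_ifs <;> rfl

/-- An invariant of the loop over all vertices. -/
theorem VCmd.semAll_induct {nb : ℕ → List ℕ} {n : ℕ} {c : VCmd} {Inv : ℕ → AState → Prop}
    (h0 : Inv 0 s)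
    (hstep : ∀ i < n, ∀ s, Inv i s → Inv (i + 1) (c.sem (nb i) (s.setReg 0 i))) :
    Inv n (c.semAll nb (List.range n) s) := by
  suffices h : ∀ m ≤ n, Inv m (c.semAll nb (List.range m) s) from h n le_rfl
  intro m
  induction m with
  | zero => exact fun _ => h0
  | succ m ih =>
    intro hm
    rw [List.range_succ, VCmd.semAll, List.foldl_append]
    exact hstep m (by omega) _ (ih (by omega))

/-- An invariant of the loop over an adjacency list; `l'` is the part that has been processed. -/
theorem VCmd.nbr_induct {l : List ℕ} {c : Cmd} {Inv : List ℕ → AState → Prop} (h0 : Inv [] s)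
    (hstep : ∀ l' y, y ∈ l → ∀ s, Inv l' s → Inv (l' ++ [y]) (c.sem (s.setReg 1 y))) :
    Inv l ((VCmd.nbr c).sem l s) := by
  suffices h : ∀ l', (∀ y ∈ l', y ∈ l) → Inv l' ((VCmd.nbr c).sem l' s) from h l fun _ h => h
  intro l'
  induction l' using List.reverseRecOn with
  | nil => exact fun _ => h0
  | append_singleton l' y ih =>
    intro hl
    simp only [VCmd.sem, List.foldl_append, List.foldl_cons, List.foldl_nil]
    exact hstep l' y (hl y (by simp)) _ (ih fun z hz => hl z (by simp [hz]))

theorem degree_sem (l : List ℕ) : (degree.sem l s).reg 3 = l.length ∧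
    (∀ r, r ≠ 1 → r ≠ 3 → (degree.sem l s).reg r = s.reg r) ∧
    ∀ k a, (degree.sem l s).arr k a = s.arr k a := by
  refine VCmd.nbr_induct (Inv := fun l' t => t.reg 3 = l'.length ∧
    (∀ r, r ≠ 1 → r ≠ 3 → t.reg r = s.reg r) ∧ ∀ k a, t.arr k a = s.arr k a) ?_ ?_
  · simp only [VCmd.sem, Cmd.sem, AState.setReg_reg, AState.setReg_arr]
    exact ⟨by simp, fun r _ h => by simp [h], fun _ _ => trivial⟩
  · rintro l' y - t ⟨h1, h2, h3⟩
    simp only [Cmd.sem, AState.setReg_reg, AState.setReg_arr]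
    exact ⟨by simp [h1], fun r h h' => by simp [h, h', h2], h3⟩

theorem relax_sem (k : Fin 8) : ((relax k).sem s).reg 0 = s.reg 0 ∧
    ∀ j a, ((relax k).sem s).arr j a = if (s.arr 3 (s.reg 0) = 0 ∧ s.arr 3 (s.reg 1) = 0 ∧
      s.arr k (s.reg 1) < s.arr k (s.reg 0)) ∧ j = k ∧ a = s.reg 0 then s.arr k (s.reg 1)
      else s.arr j a := by
  constructor
  · simp [relax, Cmd.sem]
  · intro j a
    simp only [relax, Cmd.sem, Cmd.sem_ifEq, AState.setReg_reg, AState.setReg_arr,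
      AState.setArr_arr, AState.arr_ite]
    simp only [Nat.reduceEqDiff, if_true, if_false, OfNat.zero_ne_ofNat, OfNat.one_ne_ofNat]
    split_ifs <;> first | rfl | (exfalso; tauto)

end Semantics

/-! ### Effect of the phases -/

section Phases

variable {n : ℕ} {G : SimpleGraph (Fin n)} {adj : Fin n → List (Fin n)}

theorem mem_nbrs (hadj : IsAdjList G adj) {v w : Fin n} :
    (w : ℕ) ∈ nbrs adj v ↔ G.Adj v w := by
  rw [nbrs_val, List.mem_map_of_injective Fin.val_injective, (hadj v).2]

theorem exists_of_mem_nbrs (hadj : IsAdjList G adj) {v : Fin n} {y : ℕ} (hy : y ∈ nbrs adj v) :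
    ∃ w : Fin n, (w : ℕ) = y ∧ G.Adj v w := by
  have := hy
  rw [nbrs_val, List.mem_map] at this
  obtain ⟨w, hw, rfl⟩ := this
  exact ⟨w, rfl, ((hadj v).2 w).1 hw⟩

/-- The graph of the unmasked vertices; the masked ones become isolated. -/
abbrev maskedGraph (G : SimpleGraph (Fin n)) (s : AState) : SimpleGraph (Fin n) :=
  cut G {v | s.arr 3 v ≠ 0}

theorem maskedGraph_adj {s : AState} {v w : Fin n} :
    (maskedGraph G s).Adj v w ↔ G.Adj v w ∧ s.arr 3 v = 0 ∧ s.arr 3 w = 0 := by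
  simp [maskedGraph, cut]

theorem relax_spec (hadj : IsAdjList G adj) {k : Fin 8} (hk : k ≠ 3) (s : AState)
    (hr : ∀ v : Fin n, ∃ w : Fin n, (maskedGraph G s).Reachable v w ∧ s.arr k v = w) :
    (∀ j ≠ k, ∀ a, ((VCmd.nbr (relax k)).semAll (nbrs adj) (List.range n) s).arr j a =
      s.arr j a) ∧
    (∀ v : Fin n, ∃ w : Fin n, (maskedGraph G s).Reachable v w ∧
      ((VCmd.nbr (relax k)).semAll (nbrs adj) (List.range n) s).arr k v = w) ∧
    ∀ v w : Fin n, v = w ∨ (maskedGraph G s).Adj v w →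
      ((VCmd.nbr (relax k)).semAll (nbrs adj) (List.range n) s).arr k v ≤ s.arr k w := by
  set H := maskedGraph G s
  let J : AState → Prop := fun t => (∀ j ≠ k, ∀ a, t.arr j a = s.arr j a) ∧
    (∀ v : Fin n, ∃ w : Fin n, H.Reachable v w ∧ t.arr k v = w) ∧
    ∀ v : Fin n, t.arr k v ≤ s.arr k v
  have main : J _ ∧ ∀ v : Fin n, (v : ℕ) < n → ∀ w : Fin n, H.Adj v w → _ :=
    VCmd.semAll_induct (nb := nbrs adj) (n := n) (c := .nbr (relax k))
      (Inv := fun i t => J t ∧ ∀ v : Fin n, (v : ℕ) < i → ∀ w : Fin n, H.Adj v w →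
        t.arr k v ≤ s.arr k w) (s := s)
      ⟨⟨fun _ _ _ => rfl, hr, fun _ => le_rfl⟩, fun v hv => absurd hv (Nat.not_lt_zero _)⟩ ?_
  · obtain ⟨⟨h1, h2, h3⟩, h4⟩ := main
    refine ⟨h1, h2, ?_⟩
    rintro v w (rfl | h)
    · exact h3 v
    · exact h4 v v.isLt w h
  · intro i hi t ht
    have inner := VCmd.nbr_induct (l := nbrs adj i) (c := relax k) (s := t.setReg 0 i)
      (Inv := fun l' t => J t ∧ t.reg 0 = i ∧ (∀ v : Fin n, (v : ℕ) < i → ∀ w : Fin n, H.Adj v w →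
        t.arr k v ≤ s.arr k w) ∧ ∀ w : Fin n, (w : ℕ) ∈ l' → H.Adj ⟨i, hi⟩ w →
        t.arr k i ≤ s.arr k w) ⟨ht.1, by simp, ht.2, by simp⟩ ?_
    · refine ⟨inner.1, fun v hv w hvw => ?_⟩
      rcases Nat.lt_succ_iff_lt_or_eq.1 hv with hv | hv
      · exact inner.2.2.1 v hv w hvw
      · have hv : v = ⟨i, hi⟩ := Fin.ext hv
        subst hv
        exact inner.2.2.2 w ((mem_nbrs hadj (v := ⟨i, hi⟩)).2 hvw.1) hvw
    · rintro l' y hy t ⟨⟨h1, h2, h3⟩, h4, h5, h6⟩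
      obtain ⟨y, rfl, hiy⟩ := exists_of_mem_nbrs hadj (v := ⟨i, hi⟩) hy
      obtain ⟨r0, ra⟩ := relax_sem (s := t.setReg 1 y) k
      simp only [AState.setReg_reg, AState.setReg_arr, if_true, zero_ne_one, if_false, h4,
        h1 3 (Ne.symm hk)] at r0 ra
      set t' := (relax k).sem (t.setReg 1 y)
      have hmono : ∀ a, t'.arr k a ≤ t.arr k a := by
        intro a
        rw [ra]
        split_ifs with h
        · rw [h.2.2]; exact h.1.2.2.le
        · exact le_rfl
      refine ⟨⟨fun j hj a => ?_, fun v => ?_, fun v => (hmono v).trans (h3 v)⟩, r0,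
        fun v hv w hvw => (hmono v).trans (h5 v hv w hvw), fun w hw hiw => ?_⟩
      · rw [ra, if_neg (fun h => hj h.2.1), h1 j hj]
      · rw [ra]
        split_ifs with h
        · have hv : v = ⟨i, hi⟩ := Fin.ext h.2.2
          subst hv
          have hadj' : H.Adj ⟨i, hi⟩ y := maskedGraph_adj.2 ⟨hiy, h.1.1, h.1.2.1⟩
          obtain ⟨w, hw, e⟩ := h2 y
          exact ⟨w, hadj'.reachable.trans hw, e⟩
        · exact h2 v
      · rcases List.mem_append.1 hw with hw | hw
        · exact (hmono i).trans (h6 w hw hiw)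
        · have hw : w = y := Fin.ext (by simpa using hw)
          subst hw
          have hm := (maskedGraph_adj.1 hiw).2
          rw [ra]
          split_ifs with h
          · exact h3 w
          · have : ¬ t.arr k w < t.arr k i := fun hlt => h ⟨⟨hm.1, hm.2, hlt⟩, rfl, rfl⟩
            exact (not_lt.1 this).trans (h3 w)

theorem store_spec (k : Fin 8) (s : AState) :
    (∀ j ≠ k, ∀ a, ((VCmd.cmd (.store k 0 0)).semAll (nbrs adj) (List.range n) s).arr j a =
      s.arr j a) ∧
    ∀ v < n, ((VCmd.cmd (.store k 0 0)).semAll (nbrs adj) (List.range n) s).arr k v = v := by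
  refine VCmd.semAll_induct (Inv := fun i t => (∀ j ≠ k, ∀ a, t.arr j a = s.arr j a) ∧
    ∀ v < i, t.arr k v = v) ⟨fun _ _ _ => rfl, by simp⟩ ?_
  rintro i - t ⟨h1, h2⟩
  refine ⟨fun j hj a => ?_, fun v hv => ?_⟩
  · simp [VCmd.sem, Cmd.sem, hj, h1]
  · by_cases hvi : v = i
    · simp [VCmd.sem, Cmd.sem, hvi]
    · simp [VCmd.sem, Cmd.sem, hvi, h2 v (by omega)]

theorem semList_append (nb : ℕ → List ℕ) (A B : List VCmd) (s : AState) :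
    semList nb n (A ++ B) s = semList nb n B (semList nb n A s) :=
  List.foldl_append

/-- Three rounds suffice to label the components of the unmasked part of the graph. -/
theorem labelComponents_spec (hG : IsP4Sparse G) (hadj : IsAdjList G adj) {k : Fin 8}
    (hk : k ≠ 3) (s : AState) :
    (∀ j ≠ k, ∀ a, (semList (nbrs adj) n (labelComponents k) s).arr j a = s.arr j a) ∧
    ∃ ρ : Fin n → Fin n, IsRep (maskedGraph G s) ρ ∧
      ∀ v : Fin n, (semList (nbrs adj) n (labelComponents k) s).arr k v = ρ v := by
  simp only [semList, labelComponents, List.foldl_cons, List.foldl_nil]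
  obtain ⟨f₀, e₀⟩ := store_spec (n := n) (adj := adj) k s
  set s₀ := (VCmd.cmd (.store k 0 0)).semAll (nbrs adj) (List.range n) s
  have hmask : ∀ t : AState, (∀ j ≠ k, ∀ a, t.arr j a = s.arr j a) →
      maskedGraph G t = maskedGraph G s := fun t h => by
    simp only [maskedGraph, h 3 (Ne.symm hk)]
  obtain ⟨f₁, r₁, e₁⟩ := relax_spec hadj hk s₀ fun v => ⟨v, .refl _, e₀ v v.isLt⟩
  set s₁ := (VCmd.nbr (relax k)).semAll (nbrs adj) (List.range n) s₀
  have g₁ : ∀ j ≠ k, ∀ a, s₁.arr j a = s.arr j a := fun j hj a => by rw [f₁ j hj, f₀ j hj]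
  rw [hmask s₀ f₀] at r₁ e₁
  obtain ⟨f₂, r₂, e₂⟩ := relax_spec hadj hk s₁ (by rwa [hmask s₁ g₁])
  set s₂ := (VCmd.nbr (relax k)).semAll (nbrs adj) (List.range n) s₁
  have g₂ : ∀ j ≠ k, ∀ a, s₂.arr j a = s.arr j a := fun j hj a => by rw [f₂ j hj, g₁ j hj]
  rw [hmask s₁ g₁] at r₂ e₂
  obtain ⟨f₃, r₃, e₃⟩ := relax_spec hadj hk s₂ (by rwa [hmask s₂ g₂])
  rw [hmask s₂ g₂] at r₃ e₃
  exact ⟨fun j hj a => by rw [f₃ j hj, g₂ j hj],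
    (hG.cut _).exists_isRep (fun v => e₀ v v.isLt) e₁ e₂ e₃ r₃⟩

theorem countLabel_spec (s : AState) (hs : ∀ a, s.arr 1 a = 0) :
    (∀ j ≠ 1, ∀ a, ((VCmd.cmd countLabel).semAll (nbrs adj) (List.range n) s).arr j a =
      s.arr j a) ∧
    ∀ a, ((VCmd.cmd countLabel).semAll (nbrs adj) (List.range n) s).arr 1 a =
      (Finset.univ.filter fun v : Fin n => s.arr 0 v = a).card := by
  have := VCmd.semAll_induct (nb := nbrs adj) (n := n) (c := .cmd countLabel) (s := s)
    (Inv := fun i t => (∀ j ≠ 1, ∀ a, t.arr j a = s.arr j a) ∧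
      ∀ a, t.arr 1 a = (Finset.univ.filter fun v : Fin n => (v : ℕ) < i ∧ s.arr 0 v = a).card)
    ⟨fun _ _ _ => rfl, by simp [hs]⟩ ?_
  · simpa using this
  · rintro i hi t ⟨h1, h2⟩
    refine ⟨fun j hj a => ?_, fun a => ?_⟩
    · simp [VCmd.sem, countLabel, Cmd.sem, hj, h1]
    · have h0 := h1 0 (by decide) i
      simp only [VCmd.sem, countLabel, Cmd.sem, AState.setReg_reg, AState.setReg_arr,
        AState.setArr_arr]
      simp only [Nat.reduceEqDiff, if_true, if_false, OfNat.ofNat_ne_zero, true_and, h0]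
      by_cases ha : a = s.arr 0 i
      · subst ha
        rw [if_pos rfl, h2]
        rw [← Finset.card_insert_of_notMem (a := (⟨i, hi⟩ : Fin n)) (by simp)]
        congr 1
        ext v
        simp only [Finset.mem_insert, Finset.mem_filter, Finset.mem_univ, true_and, Fin.ext_iff]
        constructor
        · rintro (hv | hv)
          · exact ⟨by omega, by rw [hv]⟩
          · exact ⟨by omega, hv.2⟩
        · rintro ⟨hv, hv'⟩
          by_cases hvi : (v : ℕ) = i
          · exact Or.inl hvi
          · exact Or.inr ⟨by omega, hv'⟩
      · rw [if_neg (by simpa using ha), h2]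
        congr 1
        ext v
        simp only [Finset.mem_filter, Finset.mem_univ, true_and]
        refine ⟨fun ⟨h, h'⟩ => ⟨by omega, h'⟩, fun ⟨h, h'⟩ => ⟨?_, h'⟩⟩
        have : (v : ℕ) ≠ i := fun e => ha (by rw [← h', e])
        omega

theorem maskDominating_sem (l : List ℕ) (s : AState) (j : Fin 8) (a : ℕ) :
    (maskDominating.sem l s).arr j a =
      if l.length + 1 = s.arr 1 (s.arr 0 (s.reg 0)) ∧ s.arr 2 (s.arr 0 (s.reg 0)) = 0 ∧
        (j = 3 ∧ a = s.reg 0 ∨ j = 2 ∧ a = s.arr 0 (s.reg 0)) then 1 else s.arr j a := by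
  obtain ⟨h1, h2, h3⟩ := degree_sem (s := s) l
  have h4 := h2 0 (by decide) (by decide)
  simp only [maskDominating, VCmd.sem, Cmd.sem, Cmd.sem_ifEq, AState.setReg_reg,
    AState.setReg_arr, AState.setArr_arr, AState.arr_ite, AState.setArr_reg, h1, h3, h4]
  simp only [Nat.reduceEqDiff, if_true, if_false, OfNat.zero_ne_ofNat]
  split_ifs <;> first | rfl | (exfalso; tauto)

/-- Exactly one vertex is masked in each component that has a vertex of sufficient degree. -/
theorem maskDominating_spec (s : AState) (h2 : ∀ a, s.arr 2 a = 0) (h3 : ∀ a, s.arr 3 a = 0) :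
    ∃ t, t = maskDominating.semAll (nbrs adj) (List.range n) s ∧
    (∀ j, j ≠ 2 → j ≠ 3 → ∀ a, t.arr j a = s.arr j a) ∧
    (∀ v : Fin n, t.arr 3 v ≠ 0 → (nbrs adj v).length + 1 = s.arr 1 (s.arr 0 v)) ∧
    (∀ a, t.arr 2 a ≠ 0 ↔ ∃ v : Fin n, t.arr 3 v ≠ 0 ∧ s.arr 0 v = a) ∧
    (∀ v w : Fin n, t.arr 3 v ≠ 0 → t.arr 3 w ≠ 0 → s.arr 0 v = s.arr 0 w → v = w) ∧
    ∀ v : Fin n, (nbrs adj v).length + 1 = s.arr 1 (s.arr 0 v) → t.arr 2 (s.arr 0 v) ≠ 0 := by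
  have := VCmd.semAll_induct (nb := nbrs adj) (n := n) (c := maskDominating) (s := s)
    (Inv := fun i t => (∀ j, j ≠ 2 → j ≠ 3 → ∀ a, t.arr j a = s.arr j a) ∧
      (∀ v : Fin n, t.arr 3 v ≠ 0 →
        (v : ℕ) < i ∧ (nbrs adj v).length + 1 = s.arr 1 (s.arr 0 v)) ∧
      (∀ a, t.arr 2 a ≠ 0 ↔ ∃ v : Fin n, t.arr 3 v ≠ 0 ∧ s.arr 0 v = a) ∧
      (∀ v w : Fin n, t.arr 3 v ≠ 0 → t.arr 3 w ≠ 0 → s.arr 0 v = s.arr 0 w → v = w) ∧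
      ∀ v : Fin n, (v : ℕ) < i → (nbrs adj v).length + 1 = s.arr 1 (s.arr 0 v) →
        t.arr 2 (s.arr 0 v) ≠ 0)
    ⟨fun _ _ _ _ => rfl, by simp [h3], by simp [h2, h3], by simp [h3], by simp⟩ ?_
  · obtain ⟨q1, q2, q3, q4, q5⟩ := this
    exact ⟨_, rfl, q1, fun v h => (q2 v h).2, q3, q4, fun v => q5 v v.isLt⟩
  · rintro i hi t ⟨q1, q2, q3, q4, q5⟩
    have hsem := maskDominating_sem (nbrs adj i) (t.setReg 0 i)
    simp only [AState.setReg_reg, AState.setReg_arr, if_true] at hsem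
    rw [q1 0 (by decide) (by decide), q1 1 (by decide) (by decide)] at hsem
    set t' := maskDominating.sem (nbrs adj i) (t.setReg 0 i)
    by_cases hc : (nbrs adj i).length + 1 = s.arr 1 (s.arr 0 i) ∧ t.arr 2 (s.arr 0 i) = 0
    · have e3 : ∀ v : Fin n, t'.arr 3 v ≠ 0 ↔ (v : ℕ) = i ∨ t.arr 3 v ≠ 0 := fun v => by
        rw [hsem]
        by_cases hv : (v : ℕ) = i <;> simp [hc, hv]
      have e2 : ∀ a, t'.arr 2 a ≠ 0 ↔ a = s.arr 0 i ∨ t.arr 2 a ≠ 0 := fun a => by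
        rw [hsem]
        by_cases ha : a = s.arr 0 i <;> simp [hc, ha]
      have hfresh : ∀ v : Fin n, t.arr 3 v ≠ 0 → s.arr 0 v ≠ s.arr 0 i := fun v hv e =>
        (q3 (s.arr 0 i)).2 ⟨v, hv, e⟩ hc.2
      refine ⟨fun j h h' a => ?_, fun v hv => ?_, fun a => ?_, fun v w hv hw hvw => ?_,
        fun v hv hd => ?_⟩
      · rw [hsem, if_neg (by tauto), q1 j h h']
      · rcases (e3 v).1 hv with hv | hv
        · rw [hv]
          exact ⟨by omega, hc.1⟩
        · exact ⟨(q2 v hv).1.trans (Nat.lt_succ_self i), (q2 v hv).2⟩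
      · rw [e2, q3]
        constructor
        · rintro (rfl | ⟨v, hv, rfl⟩)
          · exact ⟨⟨i, hi⟩, (e3 _).2 (Or.inl rfl), rfl⟩
          · exact ⟨v, (e3 v).2 (Or.inr hv), rfl⟩
        · rintro ⟨v, hv, rfl⟩
          rcases (e3 v).1 hv with hv | hv
          · exact Or.inl (by rw [hv])
          · exact Or.inr ⟨v, hv, rfl⟩
      · rcases (e3 v).1 hv with hv | hv <;> rcases (e3 w).1 hw with hw | hw
        · exact Fin.ext (hv.trans hw.symm)
        · exact absurd (by rw [← hvw, hv]) (hfresh w hw)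
        · exact absurd (by rw [hvw, hw]) (hfresh v hv)
        · exact q4 v w hv hw hvw
      · by_cases hvi : (v : ℕ) = i
        · exact (e2 _).2 (Or.inl (by rw [hvi]))
        · exact (e2 _).2 (Or.inr (q5 v (by omega) hd))
    · have hsame : ∀ j a, t'.arr j a = t.arr j a := fun j a => by rw [hsem, if_neg (by tauto)]
      simp only [hsame]
      refine ⟨q1, fun v hv => ⟨(q2 v hv).1.trans (Nat.lt_succ_self i), (q2 v hv).2⟩, q3, q4,
        fun v hv hd => ?_⟩
      by_cases hvi : (v : ℕ) = i
      · rw [hvi] at hd ⊢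
        tauto
      · exact q5 v (by omega) hd

theorem colour_sem (s : AState) : (colour.sem s).reg 0 = s.reg 0 ∧
    ∀ j a, (colour.sem s).arr j a =
      if s.arr 0 (s.reg 0) = s.reg 1 ∧ j = 5 ∧ a = s.reg 0 then 1 else s.arr j a := by
  constructor
  · simp [colour, Cmd.sem]
  · intro j a
    simp only [colour, Cmd.sem, Cmd.sem_ifEq, AState.setReg_reg, AState.setReg_arr,
      AState.setArr_arr, AState.arr_ite]
    simp only [Nat.reduceEqDiff, if_true, if_false, OfNat.zero_ne_ofNat, OfNat.one_ne_ofNat]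
    split_ifs <;> first | rfl | (exfalso; tauto)

theorem colour_spec (s : AState) (h5 : ∀ a, s.arr 5 a = 0) :
    (∀ j ≠ 5, ∀ a, ((VCmd.nbr colour).semAll (nbrs adj) (List.range n) s).arr j a = s.arr j a) ∧
    ∀ v : Fin n, ((VCmd.nbr colour).semAll (nbrs adj) (List.range n) s).arr 5 v =
      if s.arr 0 v ∈ nbrs adj v then 1 else 0 := by
  have := VCmd.semAll_induct (nb := nbrs adj) (n := n) (c := .nbr colour) (s := s)
    (Inv := fun i t => (∀ j ≠ 5, ∀ a, t.arr j a = s.arr j a) ∧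
      ∀ a, t.arr 5 a = if a < i ∧ s.arr 0 a ∈ nbrs adj a then 1 else 0)
    ⟨fun _ _ _ => rfl, by simp [h5]⟩ ?_
  · exact ⟨this.1, fun v => by rw [this.2]; simp⟩
  · rintro i hi t ⟨h1, h2⟩
    have inner := VCmd.nbr_induct (l := nbrs adj i) (c := colour) (s := t.setReg 0 i)
      (Inv := fun l' t => t.reg 0 = i ∧ (∀ j ≠ 5, ∀ a, t.arr j a = s.arr j a) ∧
        ∀ a, t.arr 5 a = if a < i ∧ s.arr 0 a ∈ nbrs adj a ∨ a = i ∧ s.arr 0 a ∈ l'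
          then 1 else 0) ⟨by simp, h1, by simpa using h2⟩ ?_
    · refine ⟨inner.2.1, fun a => ?_⟩
      rw [inner.2.2]
      congr 1
      refine propext ⟨?_, ?_⟩
      · rintro (⟨h, h'⟩ | ⟨rfl, h⟩)
        · exact ⟨by omega, h'⟩
        · exact ⟨by omega, h⟩
      · rintro ⟨h, h'⟩
        by_cases ha : a = i
        · exact Or.inr ⟨ha, ha ▸ h'⟩
        · exact Or.inl ⟨by omega, h'⟩
    · rintro l' y - t ⟨q1, q2, q3⟩
      obtain ⟨r0, ra⟩ := colour_sem (t.setReg 1 y)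
      simp only [AState.setReg_reg, AState.setReg_arr, if_true, zero_ne_one, if_false, q1] at r0 ra
      refine ⟨r0, fun j hj a => by rw [ra, if_neg (by tauto), q2 j hj], fun a => ?_⟩
      rw [ra, q3, q2 0 (by decide)]
      by_cases ha : a = i
      · subst ha
        simp only [lt_irrefl, false_and, true_and, false_or, and_true, List.mem_append,
          List.mem_singleton]
        split_ifs <;> first | rfl | (exfalso; tauto)
      · simp [ha]

theorem checkColour_sem (s : AState) : (checkColour.sem s).reg 0 = s.reg 0 ∧
    ∀ j a, (checkColour.sem s).arr j a =
      if s.arr 5 (s.reg 0) = s.arr 5 (s.reg 1) ∧ j = 6 ∧ a = s.arr 0 (s.reg 0) then 1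
      else s.arr j a := by
  constructor
  · simp [checkColour, Cmd.sem]
  · intro j a
    simp only [checkColour, Cmd.sem, Cmd.sem_ifEq, AState.setReg_reg, AState.setReg_arr,
      AState.setArr_arr, AState.arr_ite]
    simp only [Nat.reduceEqDiff, if_true, if_false, OfNat.zero_ne_ofNat, OfNat.one_ne_ofNat]
    split_ifs <;> first | rfl | (exfalso; tauto)

theorem flagComponent_sem (l : List ℕ) (s : AState) :
    (∀ j ≠ 6, ∀ a, (flagComponent.sem l s).arr j a = s.arr j a) ∧
    ∀ a, (flagComponent.sem l s).arr 6 a ≠ 0 ↔ s.arr 6 a ≠ 0 ∨ a = s.arr 0 (s.reg 0) ∧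
      (l.length = 1 ∨ ∃ y ∈ l, s.arr 5 (s.reg 0) = s.arr 5 y) := by
  have inner := VCmd.nbr_induct (l := l) (c := checkColour) (s := s)
    (Inv := fun l' t => t.reg 0 = s.reg 0 ∧ (∀ j ≠ 6, ∀ a, t.arr j a = s.arr j a) ∧
      ∀ a, t.arr 6 a ≠ 0 ↔ s.arr 6 a ≠ 0 ∨ a = s.arr 0 (s.reg 0) ∧
        ∃ y ∈ l', s.arr 5 (s.reg 0) = s.arr 5 y) ⟨rfl, fun _ _ _ => rfl, by simp⟩ ?_
  · obtain ⟨q1, q2, q3⟩ := inner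
    set t := (VCmd.nbr checkColour).sem l s with ht
    obtain ⟨h1, h2, h3⟩ := degree_sem (s := t) l
    have h4 := h2 0 (by decide) (by decide)
    have e : ∀ j a, (flagComponent.sem l s).arr j a =
        if l.length = 1 ∧ j = 6 ∧ a = s.arr 0 (s.reg 0) then 1 else t.arr j a := by
      intro j a
      simp only [flagComponent, VCmd.sem, Cmd.sem, Cmd.sem_ifEq, AState.setReg_reg,
        AState.setReg_arr, AState.setArr_arr, AState.arr_ite]
      simp only [VCmd.sem] at ht
      simp only [← ht, h1, h3, h4, q1, q2 0 (by decide), Nat.reduceEqDiff, if_true, if_false,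
        OfNat.zero_ne_ofNat]
      split_ifs <;> first | rfl | (exfalso; tauto)
    refine ⟨fun j hj a => by rw [e, if_neg (by tauto), q2 j hj], fun a => ?_⟩
    rw [e]
    split_ifs with h
    · simp [h]
    · rw [q3]
      tauto
  · rintro l' y - t ⟨q1, q2, q3⟩
    obtain ⟨r0, ra⟩ := checkColour_sem (t.setReg 1 y)
    simp only [AState.setReg_reg, AState.setReg_arr, if_true, zero_ne_one, if_false, q1,
      q2 0 (by decide), q2 5 (by decide)] at r0 ra
    refine ⟨r0, fun j hj a => by rw [ra, if_neg (by tauto), q2 j hj], fun a => ?_⟩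
    rw [ra]
    simp only [List.mem_append, List.mem_singleton, or_and_right, exists_or, exists_eq_left]
    split_ifs with h
    · simp [h.1, h.2]
    · rw [q3]
      generalize (∃ x ∈ l', s.arr 5 (s.reg 0) = s.arr 5 x) = p
      tauto

theorem flagComponent_spec (s : AState) (h6 : ∀ a, s.arr 6 a = 0) :
    (∀ j ≠ 6, ∀ a, (flagComponent.semAll (nbrs adj) (List.range n) s).arr j a = s.arr j a) ∧
    ∀ a, (flagComponent.semAll (nbrs adj) (List.range n) s).arr 6 a ≠ 0 ↔
      ∃ v < n, a = s.arr 0 v ∧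
        ((nbrs adj v).length = 1 ∨ ∃ y ∈ nbrs adj v, s.arr 5 v = s.arr 5 y) := by
  refine VCmd.semAll_induct (nb := nbrs adj) (n := n) (c := flagComponent) (s := s)
    (Inv := fun i t => (∀ j ≠ 6, ∀ a, t.arr j a = s.arr j a) ∧
      ∀ a, t.arr 6 a ≠ 0 ↔ ∃ v < i, a = s.arr 0 v ∧
        ((nbrs adj v).length = 1 ∨ ∃ y ∈ nbrs adj v, s.arr 5 v = s.arr 5 y))
    ⟨fun _ _ _ => rfl, by simp [h6]⟩ ?_
  rintro i - t ⟨h1, h2⟩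
  obtain ⟨q1, q2⟩ := flagComponent_sem (nbrs adj i) (t.setReg 0 i)
  simp only [AState.setReg_reg, AState.setReg_arr, if_true] at q1 q2
  refine ⟨fun j hj a => by rw [q1 j hj, h1 j hj], fun a => ?_⟩
  rw [q2, h2]
  simp only [h1 0 (by decide), h1 5 (by decide)]
  constructor
  · rintro (⟨v, hv, h⟩ | h)
    · exact ⟨v, by omega, h⟩
    · exact ⟨i, by omega, h⟩
  · rintro ⟨v, hv, h⟩
    rcases Nat.lt_succ_iff_lt_or_eq.1 hv with hv | rfl
    · exact Or.inl ⟨v, hv, h⟩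
    · exact Or.inr h

/-- The number that `addContribution` adds at vertex `i`. -/
def contribution (nb : ℕ → List ℕ) (s : AState) (i : ℕ) : ℕ :=
  (if s.arr 4 i = i then 1 else 0) +
    if s.arr 2 (s.arr 0 i) = 0 then (if (nb i).length = 1 then 1 else 0) +
      if s.arr 0 i = i then 1 + (if s.arr 6 i = 0 then 1 else 0) else 0 else 0

theorem addContribution_sem (nb : ℕ → List ℕ) (s : AState) (i : ℕ) :
    (∀ j a, (addContribution.sem (nb i) (s.setReg 0 i)).arr j a = s.arr j a) ∧
    (addContribution.sem (nb i) (s.setReg 0 i)).reg 9 = s.reg 9 + contribution nb s i := by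
  obtain ⟨h1, h2, h3⟩ := degree_sem (s := s.setReg 0 i) (nb i)
  have h4 := h2 0 (by decide) (by decide)
  have h5 := h2 9 (by decide) (by decide)
  simp only [AState.setReg_reg, if_true, AState.setReg_arr] at h3 h4 h5
  constructor
  · intro j a
    simp [addContribution, VCmd.sem, Cmd.sem, h3]
  · simp only [addContribution, VCmd.sem, Cmd.sem, Cmd.sem_ifEq, AState.setReg_reg,
      AState.setReg_arr, AState.arr_ite, AState.reg_ite, contribution]
    simp only [h1, h3, h4, h5, Nat.reduceEqDiff, if_true, if_false, OfNat.zero_ne_ofNat,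
      OfNat.ofNat_ne_zero, ite_self]
    split_ifs <;> first | omega | (exfalso; simp_all)

theorem addContribution_spec (nb : ℕ → List ℕ) (s : AState) :
    (addContribution.semAll nb (List.range n) s).reg 9 =
      s.reg 9 + ∑ i ∈ Finset.range n, contribution nb s i := by
  refine (VCmd.semAll_induct (nb := nb) (n := n) (c := addContribution) (s := s)
    (Inv := fun i t => (∀ j a, t.arr j a = s.arr j a) ∧
      t.reg 9 = s.reg 9 + ∑ i ∈ Finset.range i, contribution nb s i)
    ⟨fun _ _ => rfl, by simp⟩ ?_).2
  rintro i - t ⟨h1, h2⟩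
  obtain ⟨q1, q2⟩ := addContribution_sem nb t i
  refine ⟨fun j a => by rw [q1, h1], ?_⟩
  rw [q2, h2, Finset.sum_range_succ, ← add_assoc]
  simp only [contribution, h1]

theorem zero_spec (nb : ℕ → List ℕ) (hn : 0 < n) (s : AState) :
    (∀ j a, ((VCmd.cmd (.zero 9)).semAll nb (List.range n) s).arr j a = s.arr j a) ∧
    ((VCmd.cmd (.zero 9)).semAll nb (List.range n) s).reg 9 = 0 := by
  have := VCmd.semAll_induct (nb := nb) (n := n) (c := .cmd (.zero 9)) (s := s)
    (Inv := fun i t => (∀ j a, t.arr j a = s.arr j a) ∧ (0 < i → t.reg 9 = 0))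
    ⟨fun _ _ => rfl, by simp⟩ ?_
  · exact ⟨this.1, this.2 hn⟩
  · rintro i - t ⟨h1, -⟩
    simp [VCmd.sem, Cmd.sem, h1]

end Phases

/-! ### Correctness of the algorithm -/

theorem algorithm_spec {n : ℕ} {G : SimpleGraph (Fin n)} {adj : Fin n → List (Fin n)}
    (hn : 0 < n) (hG : IsP4Sparse G) (hadj : IsAdjList G adj) :
    (semList (nbrs adj) n algorithm .init).reg 9 = hullNumber G := by
  classical
  have hlen : ∀ v : Fin n, (nbrs adj v).length = (adj v).length := fun v => by simp [nbrs_val]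
  simp only [algorithm, semList_append]
  -- the components of the whole graph
  obtain ⟨f₁, ρ, hρ, e₁⟩ := labelComponents_spec hG hadj (k := 0) (by decide) .init
  set s₁ := semList (nbrs adj) n (labelComponents 0) .init
  have hcut : maskedGraph G .init = G := by
    ext v w
    simp [maskedGraph_adj, AState.init]
  rw [hcut] at hρ
  have z₁ : ∀ j ≠ 0, ∀ a, s₁.arr j a = 0 := fun j hj a => f₁ j hj a
  -- a dominating vertex in each component that has one
  simp only [semList, List.foldl_cons, List.foldl_nil]
  obtain ⟨f₂, e₂⟩ := countLabel_spec (n := n) (adj := adj) s₁ (z₁ 1 (by decide))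
  set s₂ := (VCmd.cmd countLabel).semAll (nbrs adj) (List.range n) s₁
  obtain ⟨s₃, hs₃, f₃, hdom, htop, huniq, hex⟩ := maskDominating_spec (n := n) (adj := adj) s₂
    (fun a => by rw [f₂ 2 (by decide), z₁ 2 (by decide)])
    (fun a => by rw [f₂ 3 (by decide), z₁ 3 (by decide)])
  rw [← hs₃]
  have l₂ : ∀ v : Fin n, s₂.arr 0 v = ρ v := fun v => by rw [f₂ 0 (by decide), e₁]
  have hdeg : ∀ v : Fin n, (nbrs adj v).length + 1 = s₂.arr 1 (s₂.arr 0 v) ↔ Dominates G v := by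
    intro v
    rw [dominates_iff hρ v (hadj v).1 (hadj v).2, hlen, l₂, e₂]
    simp only [e₁, Fin.val_inj]
  simp only [hdeg] at hdom hex
  simp only [l₂] at htop huniq hex
  set U : Set (Fin n) := {v | s₃.arr 3 v ≠ 0}
  have htop' : ∀ v : Fin n, s₃.arr 2 (ρ v) ≠ 0 ↔ ∃ u ∈ U, G.Reachable v u := by
    intro v
    rw [htop]
    refine exists_congr fun u => and_congr_right fun _ => ?_
    rw [Fin.val_inj, eq_comm, hρ.eq_iff]
  -- the components of the rest
  obtain ⟨f₄, ρ', hρ', e₄⟩ := labelComponents_spec hG hadj (k := 4) (by decide) s₃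
  simp only [semList] at f₄ e₄
  set s₄ := (labelComponents 4).foldl (fun s c => c.semAll (nbrs adj) (List.range n) s) s₃
  have l₄ : ∀ v : Fin n, s₄.arr 0 v = ρ v := fun v => by
    rw [f₄ 0 (by decide), f₃ 0 (by decide) (by decide), l₂]
  have z₄ : ∀ j, j ≠ 0 → j ≠ 1 → j ≠ 2 → j ≠ 3 → j ≠ 4 → ∀ a, s₄.arr j a = 0 :=
    fun j h0 h1 h2 h3 h4 a => by rw [f₄ j h4, f₃ j h2 h3, f₂ j h1, z₁ j h0]
  -- the components without leaves and triangles
  obtain ⟨f₅, e₅⟩ := colour_spec (n := n) (adj := adj) s₄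
    (z₄ 5 (by decide) (by decide) (by decide) (by decide) (by decide))
  set s₅ := (VCmd.nbr colour).semAll (nbrs adj) (List.range n) s₄
  obtain ⟨f₆, e₆⟩ := flagComponent_spec (n := n) (adj := adj) s₅ (fun a => by
    rw [f₅ 6 (by decide), z₄ 6 (by decide) (by decide) (by decide) (by decide) (by decide)])
  set s₆ := flagComponent.semAll (nbrs adj) (List.range n) s₅
  obtain ⟨f₇, e₇⟩ := zero_spec (n := n) (nbrs adj) hn s₆
  set s₇ := (VCmd.cmd (.zero 9)).semAll (nbrs adj) (List.range n) s₆
  have hcol : ∀ v : Fin n, s₅.arr 5 v = if G.Adj v (ρ v) then 1 else 0 := fun v => by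
    simp only [e₅, l₄, mem_nbrs hadj]
  have hleaf : ∀ v : Fin n, (nbrs adj v).length = 1 ↔ IsLeaf G v := fun v => by
    rw [hlen, isLeaf_iff (hadj v).1 (hadj v).2]
  have hplain : ∀ r : Fin n, ρ r = r → (s₆.arr 6 r = 0 ↔ Plain G r) := by
    intro r hr
    rw [hG.plain_iff, ← not_iff_not, ← ne_eq, e₆]
    push Not
    constructor
    · rintro ⟨v, hv, hrv, h⟩
      lift v to Fin n using hv
      rw [f₅ 0 (by decide), l₄, Fin.val_inj] at hrv
      refine ⟨v, hρ.reachable_of_eq hrv.symm, fun hl => ?_⟩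
      obtain ⟨y, hy, hvy⟩ := h.resolve_left fun h => hl ((hleaf v).1 h)
      obtain ⟨y, rfl, hadj'⟩ := exists_of_mem_nbrs hadj hy
      refine ⟨y, hadj', ?_⟩
      have hry : ρ y = r := (hρ.eq _ _ hadj'.reachable).symm.trans hrv.symm
      rw [hcol, hcol, ← hrv, hry] at hvy
      by_cases h1 : G.Adj v r <;> by_cases h2 : G.Adj y r <;> simp [h1, h2] at hvy ⊢
    · rintro ⟨v, hrv, h⟩
      have hv : ρ v = r := (hρ.eq _ _ hrv.symm).trans hr
      refine ⟨v, v.isLt, by rw [f₅ 0 (by decide), l₄, hv], ?_⟩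
      by_cases hl : IsLeaf G v
      · exact Or.inl ((hleaf v).2 hl)
      · obtain ⟨y, hvy, hiff⟩ := h hl
        refine Or.inr ⟨y, (mem_nbrs hadj).2 hvy, ?_⟩
        have hy : ρ y = r := (hρ.eq _ _ hvy.symm.reachable).trans hv
        rw [hcol, hcol, hv, hy]
        simp only [hiff]
  have g₇ : ∀ j, j ≠ 5 → j ≠ 6 → ∀ a, s₇.arr j a = s₄.arr j a := fun j h5 h6 a => by
    rw [f₇, f₆ j h6, f₅ j h5]
  rw [addContribution_spec, e₇, zero_add, Finset.sum_range, hG.hullNumber_eq (U := U)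
    (fun u hu => hdom u hu)
    (fun u hu u' hu' h => huniq u' u hu' hu (congrArg Fin.val (hρ.eq _ _ h.symm)))
    (fun v hv => (htop' v).1 (hex v hv)) hρ hρ']
  refine Finset.sum_congr rfl fun v _ => ?_
  simp only [contribution, g₇ 4 (by decide) (by decide), g₇ 2 (by decide) (by decide),
    g₇ 0 (by decide) (by decide), e₄, l₄, f₄ 2 (by decide), hleaf, Fin.val_inj, f₇]
  refine congrArg₂ (· + ·) (by congr) ?_
  by_cases ht : ∃ u ∈ U, G.Reachable v u
  · rw [if_pos ht, if_neg ((htop' v).2 ht)]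
  · rw [if_neg ht, if_pos (not_not.1 (mt (htop' v).1 ht))]
    refine congrArg₂ (· + ·) (by congr) ?_
    by_cases hv : ρ v = v
    · simp only [if_pos hv, hplain v hv]
    · simp only [if_neg hv]

end CycleConvexity

/-- One fixed program computes, from the adjacency lists of any nonempty `P₄`-sparse graph with
`n` vertices and `m` edges, the hull number of the graph in the cycle convexity (into register
`0`) in at most `c * (n + m)` steps, on a machine with words of size at most `c * (n + m)`. -/
theorem mainTheorem5 :
    ∃ (P : CycleConvexity.Prog) (c : ℕ),
      ∀ (n : ℕ) (G : SimpleGraph (Fin n)) (adj : Fin n → List (Fin n)),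
        0 < n → CycleConvexity.IsP4Sparse G → CycleConvexity.IsAdjList G adj →
          ∃ (σ : CycleConvexity.State) (t : ℕ),
            CycleConvexity.Exec (c * (n + G.edgeSet.ncard)) P
              (CycleConvexity.initState (CycleConvexity.encode adj)) σ t ∧
            t ≤ c * (n + G.edgeSet.ncard) ∧
            σ.reg 0 = CycleConvexity.hullNumber G := by
  obtain ⟨P, c, h⟩ := CycleConvexity.exists_program CycleConvexity.algorithm 9
  refine ⟨P, c, fun n G adj hn hG hadj => ?_⟩
  obtain ⟨σ, t, hx, ht, hres⟩ := h n G adj hn hadj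
  exact ⟨σ, t, hx, ht, hres.trans (CycleConvexity.algorithm_spec hn hG hadj)⟩
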